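/- Setting. Fix a history-dependent decision process with finite observation set $\mathcal O$, finite action set $\mathcal A$ and episodes $o_0,a_0,\dots,o_T,a_T$: an initial law on $\mathcal O$, transition probabilities $p(o_{t+1}\mid h_t,a_t)$ for $t<T$, where $h_t=[o_0,a_0,\dots,a_{t-1},o_t]$ is the history, and a reward function $r(h,a)$. Let $\mathcal H$ be the (finite) set of histories, $g_t=\sum_{k=t}^{T} r(h_k,a_k)$ the return, $J(\pi)=\mathbb E_\pi[g_0]$ the objective of a policy $\pi(a\mid h)$, and $b:\mathcal H\to\mathbb R$ a baseline. Let $\pi_x$ ($x\in\mathbb R^d$) be policies that are differentiable in $x$ (PG policies), and $\pi_y$ ($y\in\mathbb R^e$) arbitrary policies (MCTS policies; no regularity in $y$ is required, and they may be deterministic, as in UCT). For mixing probabilities $\lambda_n:\mathcal H\to[0,1]$ put $\pi^{n}_{x,y}(a\mid h)=(1-\lambda_n(h))\,\pi_x(a\mid h)+\lambda_n(h)\,\pi_y(a\mid h)$, and let $$h_n(x,y)=\mathbb E_{\pi^{n}_{x,y}}\Big[\sum_{t=0}^{T}\nabla_x\log\pi^{n}_{x,y}(a_t\mid h_t)\,\big(g_t-b(h_t)\big)\Big]$$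 be the expected policy-gradient update function. On a probability space let random vectors $x_n,y_n$ satisfy, almost surely for all $n\ge 0$, $$x_{n+1}=x_n+\alpha_n\big[h_n(x_n,y_n)+M_{n+1}+\epsilon_n\big],\qquad y_{n+1}=y_n+\eta_n\big[g(x_n,y_n)+N_{n+1}+\delta_n\big],$$ where nothing is assumed about the step sizes $\eta_n\in\mathbb R$, the map $g$, the noise $N_n$ (random vectors) and the bias $\delta_n$ of the MCTS iterate. Let $\mathcal F_n=\sigma(x_m,y_m,M_m,N_m;\ m\le n)$. Assume: 1. (noise, PG iterate only) for all $n\ge1$, $M_{n+1}$ is square-integrable, $\mathbb E[M_{n+1}\mid\mathcal F_n]=0$ and $\mathbb E[\|M_{n+1}\|^2\mid\mathcal F_n]\le K\,(1+\|x_n\|^2)$ almost surely, for a finite $K$, which may be a constant or random but does not depend on $n$; 2. (bias, PG iterate only) $\epsilon_n\to0$ almost surely, where $\epsilon_n$ may be deterministic or random; 3. $h_n(\cdot,y)$ is Lipschitz continuous in $x$, with a constant that depends neither on $n$ nor on $y$; 4. $\sup_n\|x_n\|<\infty$ almost surely; 5. $\lambda_n(h)\to0$ as $n\to\infty$ for every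 $h\in\mathcal H$, and $0\le\lambda_n\le1-\varepsilon$ for all $n$ and a constant $\varepsilon>0$; 6. the deterministic step sizes satisfy $\alpha_n\ge0$, $\sum_n\alpha_n=\infty$ and $\sum_n\alpha_n^2<\infty$. Then, almost surely, there is a (possibly sample-path dependent) nonempty compact connected set $S\subset\mathbb R^d$ that is invariant and internally chain transitive for the ODE $\dot x(\tau)=\nabla_xJ(\pi_{x(\tau)})$ and to which $x_n$ converges, i.e. $\operatorname{dist}(x_n,S)\to0$. Here $S$ is invariant if every trajectory $x:\mathbb R\to\mathbb R^d$ of the ODE with $x(0)\in S$ stays in $S$ for all times, and internally chain transitive if for all $p,q\in S$ and $\epsilon,\tau>0$ there are $n\ge1$ and $z_0=p,z_1,\dots,z_n=q$ in $S$ such that, for each $i<n$, the trajectory starting at $z_i$ is within distance less than $\epsilon$ of $z_{i+1}$ at some time $t\ge\tau$. -/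

import Mathlib

open MeasureTheory Filter Topology
open scoped NNReal

namespace PGMCTS

/-! ### History-dependent decision processes

Time runs over `0, …, T`; `O` and `A` are the finite sets of observations and actions. -/

/-- Histories at time `t`: `(O × A)^t × O`, that is `[o₀, a₀, …, o_{t-1}, a_{t-1}, o_t]`. -/
abbrev Hist (O A : Type*) (t : ℕ) : Type _ := (Fin t → O × A) × O

/-- The set of all histories up to the final time `T`. -/
abbrev History (O A : Type*) (T : ℕ) : Type _ := Σ t : Fin (T + 1), Hist O A t

/-- A history-dependent decision process with episodes `o₀, a₀, …, o_T, a_T`. -/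
structure HDP (O A : Type*) [Fintype O] [Fintype A] (T : ℕ) where
  /-- law of the initial observation -/
  pini : O → ℝ
  pini_nonneg : ∀ o, 0 ≤ pini o
  pini_sum : ∑ o, pini o = 1
  /-- `po t h a o` is the probability of `o_{t+1} = o` given `h_t = h` and `a_t = a` -/
  po : (t : Fin T) → Hist O A t → A → O → ℝ
  po_nonneg : ∀ t h a o, 0 ≤ po t h a o
  po_sum : ∀ t h a, ∑ o, po t h a o = 1
  /-- reward function -/
  rew : History O A T → A → ℝ

/-- `π h a` is the probability of choosing the action `a` at the history `h`. -/
def IsPolicy {O A : Type*} [Fintype A] {T : ℕ} (π : History O A T → A → ℝ) : Prop :=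
  (∀ h a, 0 ≤ π h a) ∧ ∀ h, ∑ a, π h a = 1

/-- The mixture `(1 - lam) π + lam ρ` of two policies. -/
def mix {O A : Type*} {T : ℕ} (lam : History O A T → ℝ) (π ρ : History O A T → A → ℝ) :
    History O A T → A → ℝ :=
  fun h a => (1 - lam h) * π h a + lam h * ρ h a

/-- Episodes `(o₀, a₀), …, (o_T, a_T)`. -/
abbrev Episode (O A : Type*) (T : ℕ) : Type _ := Fin (T + 1) → O × A

/-- The history `h_t` of an episode, at a fixed time `t`. -/
def Episode.histAt {O A : Type*} {T : ℕ} (e : Episode O A T) (t : Fin (T + 1)) : Hist O A t :=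
  (fun i => e ⟨i, i.2.trans t.2⟩, (e t).1)

/-- The history `h_t` of an episode, as an element of the set of all histories. -/
def Episode.hist {O A : Type*} {T : ℕ} (e : Episode O A T) (t : Fin (T + 1)) : History O A T :=
  ⟨t, Episode.histAt e t⟩

namespace HDP

variable {O A : Type*} [Fintype O] [Fintype A] {T : ℕ}

/-- The probability of an episode under the policy `π`. -/
def prob (E : HDP O A T) (π : History O A T → A → ℝ) (e : Episode O A T) : ℝ :=
  E.pini (e 0).1 *
    (∏ t : Fin T, E.po t (Episode.histAt e t.castSucc) (e t.castSucc).2 (e t.succ).1) *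
    ∏ t : Fin (T + 1), π (Episode.hist e t) (e t).2

/-- Expectation, under the policy `π`, of a function of the episode. -/
def expect {V : Type*} [AddCommGroup V] [Module ℝ V] (E : HDP O A T)
    (π : History O A T → A → ℝ) (f : Episode O A T → V) : V :=
  ∑ e, E.prob π e • f e

/-- The return `g_t = r_t + … + r_T` of an episode. -/
def ret (E : HDP O A T) (e : Episode O A T) (t : Fin (T + 1)) : ℝ :=
  ∑ k ∈ Finset.Ici t, E.rew (Episode.hist e k) (e k).2

/-- The objective `J(π)`, the expected return. -/
def J (E : HDP O A T) (π : History O A T → A → ℝ) : ℝ :=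
  E.expect π fun e => E.ret e 0

/-- The expected update function of the policy gradient for the mixture
`π_{x,y} = (1 - lam) π_x + lam π_y` with baseline `b`: the expectation, over episodes generated by
`π_{x,y}`, of `∑ₜ (g_t - b(h_t)) ∇_x log π_{x,y}(a_t | h_t)`. -/
noncomputable def pgMap {d e : ℕ} (E : HDP O A T)
    (πX : EuclideanSpace ℝ (Fin d) → History O A T → A → ℝ)
    (πY : EuclideanSpace ℝ (Fin e) → History O A T → A → ℝ)
    (b lam : History O A T → ℝ) (x : EuclideanSpace ℝ (Fin d)) (y : EuclideanSpace ℝ (Fin e)) :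
    EuclideanSpace ℝ (Fin d) :=
  E.expect (mix lam (πX x) (πY y)) fun ep =>
    ∑ t, (E.ret ep t - b (Episode.hist ep t)) •
      gradient (fun x' => Real.log (mix lam (πX x') (πY y) (Episode.hist ep t) (ep t).2)) x

end HDP

/-! ### Sigma-fields of the iterates -/

/-- `σ(x_m, y_m, M_m, N_m : m ≤ n)`. -/
abbrev sigmaField {Ω V W : Type*} [MeasurableSpace V] [MeasurableSpace W]
    (x : ℕ → Ω → V) (y : ℕ → Ω → W) (M : ℕ → Ω → V) (N : ℕ → Ω → W) (n : ℕ) :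
    MeasurableSpace Ω :=
  ⨆ m : ℕ, ⨆ _ : m ≤ n,
    MeasurableSpace.comap (fun ω => (x m ω, y m ω, M m ω, N m ω)) inferInstance

/-! ### Autonomous differential equations `γ' = F(γ)` -/

section ODE

variable {V : Type*} [NormedAddCommGroup V] [NormedSpace ℝ V]

/-- `γ : ℝ → V` is a trajectory, on the whole time axis, of `γ' = F(γ)`. -/
abbrev IsTrajectory (F : V → V) (γ : ℝ → V) : Prop := IsIntegralCurve γ fun _ => F

/-- A set is invariant if every trajectory that is in it at time `0` is in it at all
(positive and negative) times. -/
def IsInvariantSet (F : V → V) (S : Set V) : Prop :=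
  ∀ γ, IsTrajectory F γ → γ 0 ∈ S → ∀ t, γ t ∈ S

/-- Internal chain transitivity: any two points `p, q` of `S` are joined, for all `ε, τ > 0`, by a
chain `p = z₀, …, z_n = q` (`n ≥ 1`) of points of `S` such that the trajectory from `z_i` is
`ε`-close to `z_{i+1}` at some time `t ≥ τ`. -/
def IsInternallyChainTransitive (F : V → V) (S : Set V) : Prop :=
  ∀ p ∈ S, ∀ q ∈ S, ∀ ε > 0, ∀ τ > (0 : ℝ), ∃ n : ℕ, 1 ≤ n ∧ ∃ z : ℕ → V,
    z 0 = p ∧ z n = q ∧ (∀ i ≤ n, z i ∈ S) ∧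
    ∀ i < n, ∃ γ, IsTrajectory F γ ∧ γ 0 = z i ∧ ∃ t ≥ τ, dist (γ t) (z (i + 1)) < ε

end ODE

end PGMCTS

/-! The MCTS iterate is only a vanishing perturbation of a stochastic approximation of `∇J`. In
`h_n` the probability of the chosen action cancels the denominator of its score, which leaves `(1 -
λ_n) ∇π_x`. So `h_n` is a finite sum of products of mixed action probabilities, gradients of `π_x`
and constants, without division (`pgMap_eq_weightedGradient`). Since `π_y` takes values in `[0, 1]`,
`λ_n → 0` gives `h_n(x, y_n) → ∇J(π_x)` for every sequence `y_n` (`tendsto_pgMap`); the limit is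
identified by the policy gradient theorem `gradient_J_eq`. The uniform Lipschitz bound passes to
`∇J` and makes the convergence uniform on compact sets, so `h_n(x_n, y_n) - ∇J(π_{x_n})` tends to
zero along bounded iterates and counts as bias.

The noise series `∑ α_n M_{n+1}` converges almost surely: its conditional variances are summable on
each path, and stopping before their sum exceeds a level gives an `L²`-bounded martingale
(`ae_cauchySeq_sum_noise`).

What remains is deterministic (`exists_internallyChainTransitive_of_recursion`). By a discrete
Gronwall argument the iterates shadow ODE trajectories over bounded times. The set `S` is the set of
limit points of `x_n`; shadowing makes it invariant and chain transitive, and these two properties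
make it connected. -/

namespace PGMCTS

/-! ### Global flow of a Lipschitz vector field -/

section Flow

variable {V : Type*} [NormedAddCommGroup V] [NormedSpace ℝ V]

/-- Two trajectories of a Lipschitz vector field separate at most exponentially in forward time. -/
theorem IsTrajectory.dist_le_of_nonneg {F : V → V} {L : ℝ≥0} (hF : LipschitzWith L F)
    {γ γ' : ℝ → V} (h : IsTrajectory F γ) (h' : IsTrajectory F γ') {t : ℝ} (ht : 0 ≤ t) :
    dist (γ t) (γ' t) ≤ dist (γ 0) (γ' 0) * Real.exp (L * t) := by
  have := dist_le_of_trajectories_ODE (v := fun _ => F) (a := 0) (b := t) (fun _ => hF)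
    h.continuous.continuousOn (fun s _ => (h s).hasDerivWithinAt) h'.continuous.continuousOn
    (fun s _ => (h' s).hasDerivWithinAt) le_rfl t ⟨ht, le_rfl⟩
  simpa using this

theorem IsTrajectory.comp_neg {F : V → V} {γ : ℝ → V} (h : IsTrajectory F γ) :
    IsTrajectory (fun z => -F z) (fun t => γ (-t)) := by
  intro t
  simpa [Function.comp_def] using (h (-t)).scomp t (hasDerivAt_neg t)

/-- Reversing time turns `F` into `-F`, which has the same Lipschitz constant. -/
theorem IsTrajectory.dist_le {F : V → V} {L : ℝ≥0} (hF : LipschitzWith L F)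
    {γ γ' : ℝ → V} (h : IsTrajectory F γ) (h' : IsTrajectory F γ') (t : ℝ) :
    dist (γ t) (γ' t) ≤ dist (γ 0) (γ' 0) * Real.exp (L * |t|) := by
  rcases le_total 0 t with ht | ht
  · simpa [abs_of_nonneg ht] using h.dist_le_of_nonneg hF h' ht
  · have hF' : LipschitzWith L fun z => -F z := hF.neg
    have := h.comp_neg.dist_le_of_nonneg hF' h'.comp_neg (neg_nonneg.2 ht)
    simpa [abs_of_nonpos ht] using this

theorem IsTrajectory.shift {F : V → V} {γ : ℝ → V} (h : IsTrajectory F γ) (s : ℝ) :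
    IsTrajectory F fun t => γ (t + s) :=
  IsIntegralCurve.comp_add h s

/-- The norm of a curve whose velocity grows at most linearly stays bounded on compact intervals. -/
theorem norm_le_gronwallBound_of_linear_growth {γ γ' : ℝ → V} {a b T : ℝ} (ha : 0 ≤ a) (hb : 0 ≤ b)
    (h : ∀ t ∈ Set.Icc (-T) T, HasDerivWithinAt γ (γ' t) (Set.Icc (-T) T) t)
    (hγ' : ∀ t ∈ Set.Icc (-T) T, ‖γ' t‖ ≤ a * ‖γ t‖ + b) :
    ∀ t ∈ Set.Icc (-T) T, ‖γ t‖ ≤ gronwallBound ‖γ 0‖ a b T := by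
  have key : ∀ (γ γ' : ℝ → V),
      (∀ t ∈ Set.Icc (-T) T, HasDerivWithinAt γ (γ' t) (Set.Icc (-T) T) t) →
      (∀ t ∈ Set.Icc (-T) T, ‖γ' t‖ ≤ a * ‖γ t‖ + b) →
      ∀ t ∈ Set.Icc 0 T, ‖γ t‖ ≤ gronwallBound ‖γ 0‖ a b T := by
    intro γ γ' h hγ' t ht
    have hT : 0 ≤ T := ht.1.trans ht.2
    have h1 := norm_le_gronwallBound_of_norm_deriv_right_le (f := γ) (f' := γ') (a := 0) (b := T)
      (δ := ‖γ 0‖) (K := a) (ε := b)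
      (fun s hs => ((h s ⟨by linarith [hs.1], hs.2⟩).continuousWithinAt).mono
        (Set.Icc_subset_Icc (by linarith) le_rfl))
      (fun s hs => by
        have := h s ⟨by linarith [hs.1], hs.2.le⟩
        exact this.mono_of_mem_nhdsWithin (mem_of_superset (Icc_mem_nhdsGE hs.2)
          (Set.Icc_subset_Icc (by linarith [hs.1]) le_rfl)))
      le_rfl (fun s hs => hγ' s ⟨by linarith [hs.1], hs.2.le⟩) t ht
    refine h1.trans (gronwallBound_mono (norm_nonneg _) hb ha ?_)
    linarith [ht.2]
  intro t ht
  rcases le_total 0 t with h0 | h0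
  · exact key γ γ' h hγ' t ⟨h0, ht.2⟩
  · have := key (fun s => γ (-s)) (fun s => -γ' (-s)) (fun s hs => by
      have hs' : -s ∈ Set.Icc (-T) T := ⟨by linarith [hs.2], by linarith [hs.1]⟩
      have := (h (-s) hs').scomp s (hasDerivAt_neg s).hasDerivWithinAt (s := Set.Icc (-T) T)
        (fun u hu => ⟨by linarith [hu.2], by linarith [hu.1]⟩)
      simpa [Function.comp_def] using this) (fun s hs => by
      simpa using hγ' (-s) ⟨by linarith [hs.2], by linarith [hs.1]⟩) (-t)
      ⟨by linarith, by linarith [ht.1]⟩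
    simpa using this

/-- The radial retraction onto the closed ball of radius `R`. -/
noncomputable def radialRetraction (R : ℝ) (z : V) : V := min 1 (R / ‖z‖) • z

theorem radialRetraction_of_norm_le {R : ℝ} {z : V} (hz : ‖z‖ ≤ R) : radialRetraction R z = z := by
  rcases (norm_nonneg z).eq_or_lt with h0 | h0
  · simp [radialRetraction, norm_eq_zero.1 h0.symm]
  · rw [radialRetraction, min_eq_left ((one_le_div h0).2 hz), one_smul]

theorem norm_radialRetraction_le {R : ℝ} (hR : 0 ≤ R) (z : V) :
    ‖radialRetraction R z‖ ≤ min ‖z‖ R := by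
  rw [radialRetraction, norm_smul, Real.norm_of_nonneg (by positivity)]
  rcases (norm_nonneg z).eq_or_lt with h0 | h0
  · simp [← h0, hR]
  · rw [min_mul_of_nonneg _ _ h0.le, one_mul, div_mul_cancel₀ _ h0.ne']

/-- The constant 2 comes from the triangle inequality, since `V` is a general normed space: changing
the point at a fixed factor and changing the factor at the shorter point each cost at most `‖z -
w‖`. -/
theorem lipschitzWith_radialRetraction {R : ℝ} (hR : 0 < R) :
    LipschitzWith 2 (radialRetraction R : V → V) := by
  refine LipschitzWith.of_dist_le_mul fun z w => ?_
  wlog hzw : ‖w‖ ≤ ‖z‖ generalizing z w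
  · rw [dist_comm, dist_comm z]
    exact this w z (le_of_not_ge hzw)
  have hc : ∀ v : V, 0 ≤ min 1 (R / ‖v‖) := fun v => by positivity
  have hsplit : radialRetraction R z - radialRetraction R w =
      min 1 (R / ‖z‖) • (z - w) - (min 1 (R / ‖w‖) - min 1 (R / ‖z‖)) • w := by
    simp only [radialRetraction, smul_sub, sub_smul]; abel
  have h1 : ‖min 1 (R / ‖z‖) • (z - w)‖ ≤ ‖z - w‖ := by
    rw [norm_smul, Real.norm_of_nonneg (hc z)]
    exact mul_le_of_le_one_left (norm_nonneg _) (min_le_left _ _)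
  have h2 : ‖(min 1 (R / ‖w‖) - min 1 (R / ‖z‖)) • w‖ ≤ ‖z - w‖ := by
    rw [norm_smul]
    refine le_trans ?_ (norm_sub_norm_le z w)
    rcases (norm_nonneg w).eq_or_lt with h0 | h0
    · rw [← h0]; simp
    have hz0 : 0 < ‖z‖ := h0.trans_le hzw
    have hmono : min 1 (R / ‖z‖) ≤ min 1 (R / ‖w‖) :=
      min_le_min le_rfl (div_le_div_of_nonneg_left hR.le h0 hzw)
    rw [Real.norm_of_nonneg (sub_nonneg.2 hmono), sub_mul]
    have hw : min 1 (R / ‖w‖) * ‖w‖ = min ‖w‖ R := by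
      rw [min_mul_of_nonneg _ _ h0.le, one_mul, div_mul_cancel₀ _ h0.ne']
    have hz : min 1 (R / ‖z‖) * ‖z‖ = min ‖z‖ R := by
      rw [min_mul_of_nonneg _ _ hz0.le, one_mul, div_mul_cancel₀ _ hz0.ne']
    have h3 : min 1 (R / ‖z‖) * (‖z‖ - ‖w‖) ≤ 1 * (‖z‖ - ‖w‖) :=
      mul_le_mul_of_nonneg_right (min_le_left _ _) (sub_nonneg.2 hzw)
    have h4 : min ‖w‖ R ≤ min ‖z‖ R := min_le_min hzw le_rfl
    rw [hw]
    linarith [mul_sub (min 1 (R / ‖z‖)) ‖z‖ ‖w‖]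
  rw [dist_eq_norm, dist_eq_norm, hsplit]
  calc _ ≤ ‖z - w‖ + ‖z - w‖ := (norm_sub_le _ _).trans (add_le_add h1 h2)
    _ = _ := by push_cast; ring

/-- A Lipschitz vector field on a Banach space has integral curves on every symmetric interval. -/
theorem exists_hasDerivWithinAt_Icc [CompleteSpace V] {F : V → V} {L : ℝ≥0}
    (hF : LipschitzWith L F) (p : V) {T : ℝ} (hT : 0 ≤ T) :
    ∃ γ : ℝ → V, γ 0 = p ∧
      ∀ t ∈ Set.Icc (-T) T, HasDerivWithinAt γ (F (γ t)) (Set.Icc (-T) T) t := by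
  -- An a priori Gronwall bound for solutions on `[-T, T]`. Precomposing `F` with the retraction
  -- onto this ball makes it bounded, so Picard–Lindelöf covers the whole interval; the growth bound
  -- survives truncation, so the solution stays in the ball and solves the original equation.
  set R : ℝ := max 1 (gronwallBound ‖p‖ L ‖F 0‖ T) with hRdef
  have hR : 0 < R := lt_max_of_lt_left one_pos
  have hlin : ∀ z, ‖F z‖ ≤ L * ‖z‖ + ‖F 0‖ := fun z => by
    have h1 := hF.dist_le_mul z 0
    rw [dist_eq_norm, dist_zero_right] at h1
    linarith [norm_sub_norm_le (F z) (F 0)]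
  set G : V → V := fun z => F (radialRetraction R z) with hG
  have hGL : LipschitzWith (L * 2) G := hF.comp (lipschitzWith_radialRetraction hR)
  set B : ℝ≥0 := ⟨L * R + ‖F 0‖, by positivity⟩ with hB
  have hGB : ∀ z, ‖G z‖ ≤ B := fun z => by
    refine (hlin _).trans ?_
    have : ‖radialRetraction R z‖ ≤ R := (norm_radialRetraction_le hR.le z).trans (min_le_right _ _)
    change _ ≤ L * R + ‖F 0‖
    gcongr
  have hPL : IsPicardLindelof (fun _ => G) (tmin := -T) (tmax := T)
      ⟨0, by simp [hT], hT⟩ p (B * ⟨T, hT⟩) 0 B (L * 2) :=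
    { lipschitzOnWith := fun _ _ => hGL.lipschitzOnWith
      continuousOn := fun _ _ => continuousOn_const
      norm_le := fun _ _ z _ => hGB z
      mul_max_le := by simp; rfl }
  obtain ⟨γ, h0, hγ⟩ := hPL.exists_eq_forall_mem_Icc_hasDerivWithinAt₀
  refine ⟨γ, h0, fun t ht => ?_⟩
  have hbound := norm_le_gronwallBound_of_linear_growth L.2 (norm_nonneg (F 0)) hγ (fun s _ => by
    refine (hlin _).trans ?_
    have : ‖radialRetraction R (γ s)‖ ≤ ‖γ s‖ :=
      (norm_radialRetraction_le hR.le _).trans (min_le_left _ _)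
    have hL : (0 : ℝ) ≤ L := L.2
    exact add_le_add (mul_le_mul_of_nonneg_left this hL) le_rfl) t ht
  have h0' : γ 0 = p := h0
  rw [h0'] at hbound
  have := hγ t ht
  have heq : radialRetraction R (γ t) = γ t :=
    radialRetraction_of_norm_le (hbound.trans (le_max_right _ _))
  simpa only [hG, heq] using this

/-- A Lipschitz vector field on a Banach space has a global trajectory through every point. -/
theorem exists_isTrajectory [CompleteSpace V] {F : V → V} {L : ℝ≥0} (hF : LipschitzWith L F)
    (p : V) : ∃ γ, IsTrajectory F γ ∧ γ 0 = p := by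
  have hex : ∀ T : ℝ, ∃ γ : ℝ → V, γ 0 = p ∧ ∀ t ∈ Set.Ioo (-T) T, HasDerivAt γ (F (γ t)) t := by
    intro T
    rcases le_total 0 T with hT | hT
    · obtain ⟨γ, h0, hγ⟩ := exists_hasDerivWithinAt_Icc hF p hT
      exact ⟨γ, h0, fun t ht => (hγ t ⟨ht.1.le, ht.2.le⟩).hasDerivAt (Icc_mem_nhds ht.1 ht.2)⟩
    · exact ⟨fun _ => p, rfl, fun t ht => by linarith [ht.1, ht.2]⟩
  choose γ h0 hγ using hex
  have hagree : ∀ {a b : ℝ}, 0 < a → a ≤ b → Set.EqOn (γ a) (γ b) (Set.Ioo (-a) a) := by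
    intro a b ha hab
    exact ODE_solution_unique_of_mem_Ioo (v := fun _ => F) (s := fun _ => Set.univ) (K := L)
      (fun _ _ => hF.lipschitzOnWith) (t₀ := 0) ⟨by linarith, ha⟩ (fun t ht => ⟨hγ a t ht, trivial⟩)
      (fun t ht => ⟨hγ b t ⟨by linarith [ht.1], by linarith [ht.2]⟩, trivial⟩) (by rw [h0, h0])
  -- Each time is read off from a solution whose interval contains it in the interior; by uniqueness
  -- this gluing agrees near `t` with one fixed solution.
  refine ⟨fun t => γ (|t| + 1) t, fun t => ?_, h0 _⟩
  have hmem : ∀ s : ℝ, s ∈ Set.Ioo (-(|s| + 1)) (|s| + 1) := fun s => abs_lt.1 (lt_add_one _)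
  refine (hγ (|t| + 1) t (hmem t)).congr_of_eventuallyEq ?_
  filter_upwards [Ioo_mem_nhds (hmem t).1 (hmem t).2] with s hs
  rcases le_total |s| |t| with h | h
  · exact hagree (by positivity) (by linarith) (hmem s)
  · exact (hagree (by positivity) (by linarith) hs).symm

end Flow

/-! ### Shadowing of trajectories by the recursion -/

section StochasticApproximation

variable {V : Type*} [NormedAddCommGroup V] [NormedSpace ℝ V]

/-- The time `∑_{k < n} a_k` elapsed after `n` steps of sizes `a`. -/
def clock (a : ℕ → ℝ) (n : ℕ) : ℝ := ∑ k ∈ Finset.range n, a k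

theorem clock_succ (a : ℕ → ℝ) (n : ℕ) : clock a (n + 1) = clock a n + a n :=
  Finset.sum_range_succ _ _

theorem clock_mono {a : ℕ → ℝ} (ha : ∀ n, 0 ≤ a n) : Monotone (clock a) :=
  monotone_nat_of_le_succ fun n => by rw [clock_succ]; linarith [ha n]

/-- If the steps from `N` on are at most `η`, every time after `clock a N` is met up to `η`. -/
theorem exists_clock_mem_Icc {a : ℕ → ℝ} (hsum : Tendsto (clock a) atTop atTop) {N : ℕ} {η s : ℝ}
    (hη : 0 ≤ η) (haη : ∀ k ≥ N, a k ≤ η) (hs : clock a N ≤ s) :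
    ∃ k ≥ N, s ≤ clock a k ∧ clock a k ≤ s + η := by
  classical
  have hex : ∃ k, N ≤ k ∧ s ≤ clock a k :=
    ((eventually_ge_atTop N).and (hsum.eventually_ge_atTop s)).exists
  obtain ⟨h1, h2⟩ := Nat.find_spec hex
  refine ⟨Nat.find hex, h1, h2, ?_⟩
  rcases h1.eq_or_lt with h | h
  · rw [← h]; linarith
  · obtain ⟨j, hj⟩ : ∃ j, Nat.find hex = j + 1 := ⟨Nat.find hex - 1, by omega⟩
    have hmin := Nat.find_min hex (m := j) (by omega)
    rw [hj, clock_succ]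
    have : clock a j < s := by
      by_contra hc
      exact hmin ⟨by omega, not_lt.1 hc⟩
    linarith [haη j (by omega)]

/-- The iterates `x`, run with the clock of the step sizes `a`, follow the trajectories of
`γ' = F(γ)` over bounded time spans, with an error that vanishes in the limit. -/
def IsAsymptoticPseudotrajectory (F : V → V) (a : ℕ → ℝ) (x : ℕ → V) : Prop :=
  ∀ T δ : ℝ, 0 < δ → ∃ N, ∀ n ≥ N, ∀ k ≥ n, clock a k ≤ clock a n + T →
    ∀ γ, IsTrajectory F γ → γ 0 = x n → dist (x k) (γ (clock a k - clock a n)) ≤ δ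

/-- The local error of the explicit Euler scheme. -/
theorem IsTrajectory.norm_euler_error_le {F : V → V} {L : ℝ≥0} (hF : LipschitzWith L F)
    {γ : ℝ → V} (hγ : IsTrajectory F γ) {C s h : ℝ} (hh : 0 ≤ h)
    (hC : ∀ u ∈ Set.Icc s (s + h), ‖F (γ u)‖ ≤ C) :
    ‖γ (s + h) - γ s - h • F (γ s)‖ ≤ L * C * h * h := by
  have hC0 : 0 ≤ C := (norm_nonneg _).trans (hC s ⟨le_rfl, by linarith⟩)
  have h1 : ∀ u ∈ Set.Icc s (s + h), ‖γ u - γ s‖ ≤ C * h := fun u hu => by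
    refine (norm_image_sub_le_of_norm_deriv_le_segment' (fun v _ => (hγ v).hasDerivWithinAt)
      (fun v hv => hC v ⟨hv.1, hv.2.le⟩) u hu).trans ?_
    exact mul_le_mul_of_nonneg_left (by linarith [hu.2]) hC0
  have h2 := norm_image_sub_le_of_norm_deriv_le_segment' (f := fun u => γ u - u • F (γ s))
    (f' := fun u => F (γ u) - F (γ s)) (a := s) (b := s + h) (C := L * (C * h))
    (fun u _ => by
      have := (hγ u).sub ((hasDerivAt_id u).smul_const (F (γ s)))
      rw [one_smul] at this
      exact this.hasDerivWithinAt)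
    (fun u hu => by
      rw [← dist_eq_norm]
      refine (hF.dist_le_mul _ _).trans (mul_le_mul_of_nonneg_left ?_ L.2)
      rw [dist_eq_norm]
      exact h1 u ⟨hu.1, hu.2.le⟩)
    (s + h) ⟨by linarith, le_rfl⟩
  have h3 : γ (s + h) - γ s - h • F (γ s)
      = γ (s + h) - (s + h) • F (γ s) - (γ s - s • F (γ s)) := by
    rw [add_smul]; abel
  rw [h3]
  calc _ ≤ L * (C * h) * (s + h - s) := h2
    _ = _ := by ring

/-- The vector field is bounded along the trajectories that start in a bounded set, over bounded
time spans. -/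
theorem exists_norm_le_along_trajectories [CompleteSpace V] {F : V → V} {L : ℝ≥0}
    (hF : LipschitzWith L F) (R T : ℝ) :
    ∃ C, 0 ≤ C ∧ ∀ γ, IsTrajectory F γ → ‖γ 0‖ ≤ R → ∀ t ∈ Set.Icc 0 T, ‖F (γ t)‖ ≤ C := by
  obtain ⟨γ₀, hγ₀, h0⟩ := exists_isTrajectory hF (0 : V)
  obtain ⟨B, hB⟩ := isCompact_Icc.exists_bound_of_continuousOn (s := Set.Icc 0 T)
    (f := fun t => F (γ₀ t)) (hF.continuous.comp hγ₀.continuous).continuousOn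
  -- All these trajectories stay within `R * exp (L * T)` of the one through the origin.
  refine ⟨max 0 (B + L * (R * Real.exp (L * T))), le_max_left _ _, fun γ hγ hR t ht => ?_⟩
  refine le_trans ?_ (le_max_right _ _)
  have hR0 : 0 ≤ R := (norm_nonneg _).trans hR
  have h1 := hγ.dist_le_of_nonneg hF hγ₀ ht.1
  rw [h0, dist_zero_right] at h1
  have h2 : dist (γ t) (γ₀ t) ≤ R * Real.exp (L * T) := by
    refine h1.trans ?_
    have hL : (0 : ℝ) ≤ L := L.2
    have := ht.2
    gcongr
  have h3 := hF.dist_le_mul (γ t) (γ₀ t)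
  rw [dist_eq_norm] at h3
  have h4 := hB t ht
  have h5 := norm_sub_norm_le (F (γ t)) (F (γ₀ t))
  have h6 : (L : ℝ) * dist (γ t) (γ₀ t) ≤ L * (R * Real.exp (L * T)) :=
    mul_le_mul_of_nonneg_left h2 L.2
  linarith

/-- Only sums of noise terms are small, not their individual norms. The accumulated noise is
therefore subtracted first, and discrete Gronwall is applied to the remainder `v`. -/
theorem isAsymptoticPseudotrajectory_of_recursion [CompleteSpace V] {F : V → V} {L : ℝ≥0}
    (hF : LipschitzWith L F)
    {a : ℕ → ℝ} (ha : ∀ n, 0 ≤ a n) (ha0 : Tendsto a atTop (𝓝 0))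
    {x m e : ℕ → V} (hx : ∃ R, ∀ n, ‖x n‖ ≤ R)
    (hrec : ∀ n, x (n + 1) = x n + a n • (F (x n) + m n + e n))
    (hm : CauchySeq fun n => ∑ k ∈ Finset.range n, a k • m k) (he : Tendsto e atTop (𝓝 0)) :
    IsAsymptoticPseudotrajectory F a x := by
  intro T δ hδ
  obtain ⟨R, hR⟩ := hx
  obtain ⟨C, hC0, hC⟩ := exists_norm_le_along_trajectories hF R T
  have hL : (0 : ℝ) ≤ L := L.2
  set E := Real.exp (L * T) with hE
  have hEpos : 0 < E := Real.exp_pos _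
  -- `κ` bounds late step sizes, biases and noise increments alike. In the factor `L + 1 + L * C`
  -- the terms come from the noise inside `F`, the bias and the Euler error.
  obtain ⟨κ, hκ, hκδ⟩ : ∃ κ : ℝ, 0 < κ ∧
      κ + |T| * (κ * (L + 1 + L * C)) * E ≤ δ := by
    have hcont : Tendsto (fun κ : ℝ => κ + |T| * (κ * (L + 1 + L * C)) * E) (𝓝[>] 0) (𝓝 0) := by
      have : Continuous fun κ : ℝ => κ + |T| * (κ * (L + 1 + L * C)) * E := by fun_prop
      have h := this.tendsto 0
      simp only [zero_mul, mul_zero, add_zero] at h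
      exact h.mono_left nhdsWithin_le_nhds
    obtain ⟨κ, h1, h2⟩ := ((hcont.eventually_le_const hδ).and self_mem_nhdsWithin).exists
    exact ⟨κ, h2, h1⟩
  obtain ⟨N₁, hN₁⟩ := eventually_atTop.1 (ha0.eventually_le_const hκ)
  obtain ⟨N₂, hN₂⟩ := eventually_atTop.1
    ((tendsto_norm_zero.comp he).eventually_le_const hκ)
  obtain ⟨N₃, hN₃⟩ := Metric.cauchySeq_iff.1 hm κ hκ
  refine ⟨max N₁ (max N₂ N₃), fun n hn k hk hkT γ hγ hγ0 => ?_⟩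
  have hn1 : N₁ ≤ n := (le_max_left _ _).trans hn
  have hn2 : N₂ ≤ n := (le_max_left _ _).trans ((le_max_right _ _).trans hn)
  have hn3 : N₃ ≤ n := (le_max_right _ _).trans ((le_max_right _ _).trans hn)
  set W : ℕ → V := fun j => ∑ k ∈ Finset.range j, a k • m k with hW
  have hWn : ∀ j ≥ n, ‖W j - W n‖ ≤ κ := fun j hj => by
    rw [← dist_eq_norm]; exact (hN₃ j (hn3.trans hj) n hn3).le
  set u : ℕ → V := fun j => γ (clock a j - clock a n) with hu
  set v : ℕ → V := fun j => x j - u j - (W j - W n) with hv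
  have hxu : ∀ j ≥ n, ‖x j - u j‖ ≤ ‖v j‖ + κ := fun j hj => by
    have : x j - u j = v j + (W j - W n) := by simp only [hv]; abel
    rw [this]
    exact (norm_add_le _ _).trans (add_le_add le_rfl (hWn j hj))
  set B : ℝ := κ * (L + 1 + L * C) with hB
  have hB0 : 0 ≤ B := by positivity
  have key : ∀ j ≥ n, clock a j ≤ clock a n + T →
      ‖v j‖ ≤ (clock a j - clock a n) * B * Real.exp (L * (clock a j - clock a n)) := by
    intro j hj
    induction j, hj using Nat.le_induction with
    | base => intro _; simp [hv, hu, hγ0]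
    | succ j hj ih =>
      intro hjT
      have haj := ha j
      have hajκ := hN₁ j (hn1.trans hj)
      rw [clock_succ] at hjT ⊢
      have ih' := ih (by linarith)
      have hmono := clock_mono ha hj
      set τ := clock a j - clock a n with hτ
      have hτ0 : 0 ≤ τ := by linarith
      have hτ' : clock a j + a j - clock a n = τ + a j := by ring
      rw [hτ']
      have heul := hγ.norm_euler_error_le hF (C := C) (s := τ) haj (fun w hw =>
        hC γ hγ (by rw [hγ0]; exact hR n) w ⟨hτ0.trans hw.1, hw.2.trans (by linarith)⟩)
      have hsplit : v (j + 1) = v j + a j • (F (x j) - F (u j)) + a j • e j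
          - (γ (τ + a j) - γ τ - a j • F (γ τ)) := by
        simp only [hv, hu, hW, Finset.sum_range_succ, hrec j, clock_succ, hτ']
        rw [← hτ]
        simp only [smul_add, smul_sub]
        abel
      have hlip : ‖a j • (F (x j) - F (u j))‖ ≤ a j * (L * (‖v j‖ + κ)) := by
        rw [norm_smul, Real.norm_of_nonneg haj, ← dist_eq_norm]
        refine mul_le_mul_of_nonneg_left ((hF.dist_le_mul _ _).trans ?_) haj
        rw [dist_eq_norm]
        exact mul_le_mul_of_nonneg_left (hxu j hj) hL
      have hej : ‖a j • e j‖ ≤ a j * κ := by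
        rw [norm_smul, Real.norm_of_nonneg haj]
        exact mul_le_mul_of_nonneg_left (hN₂ j (hn2.trans hj)) haj
      have heul' : L * C * a j * a j ≤ L * C * κ * a j := by gcongr
      have hstep : ‖v (j + 1)‖ ≤ (1 + L * a j) * ‖v j‖ + a j * B := by
        rw [hsplit]
        refine (norm_sub_le _ _).trans ?_
        refine (add_le_add ((norm_add_le _ _).trans (add_le_add (norm_add_le _ _) le_rfl))
          le_rfl).trans ?_
        rw [hB]
        nlinarith
      have hexp : 1 + L * a j ≤ Real.exp (L * a j) := by
        linarith [Real.add_one_le_exp (L * a j)]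
      have hexp1 : 1 ≤ Real.exp (L * (τ + a j)) := Real.one_le_exp (by positivity)
      calc ‖v (j + 1)‖ ≤ (1 + L * a j) * ‖v j‖ + a j * B := hstep
        _ ≤ Real.exp (L * a j) * (τ * B * Real.exp (L * τ)) + a j * B * 1 := by
          rw [mul_one]
          gcongr
        _ ≤ Real.exp (L * a j) * (τ * B * Real.exp (L * τ))
            + a j * B * Real.exp (L * (τ + a j)) := by gcongr
        _ = (τ + a j) * B * Real.exp (L * (τ + a j)) := by
          rw [mul_add, Real.exp_add]; ring
  have hτ0 : 0 ≤ clock a k - clock a n := by linarith [clock_mono ha hk]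
  have hτT : clock a k - clock a n ≤ T := by linarith
  rw [dist_eq_norm]
  calc ‖x k - u k‖ ≤ ‖v k‖ + κ := hxu k hk
    _ ≤ |T| * B * E + κ := by
      refine add_le_add ((key k hk hkT).trans ?_) le_rfl
      have : clock a k - clock a n ≤ |T| := hτT.trans (le_abs_self T)
      rw [hE]
      gcongr
    _ ≤ δ := by linarith

end StochasticApproximation

/-! ### Limit sets of asymptotic pseudotrajectories -/

section LimitSet

variable {V : Type*} [NormedAddCommGroup V]

/-- The set of limit points of a sequence. -/
def limitSet (x : ℕ → V) : Set V := {p | MapClusterPt p atTop x}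

theorem mem_limitSet_iff {x : ℕ → V} {p : V} :
    p ∈ limitSet x ↔ ∀ ε > 0, ∀ N, ∃ n ≥ N, dist (x n) p < ε := by
  simp only [limitSet, Set.mem_ofPred_eq, Metric.nhds_basis_ball.mapClusterPt_iff_frequently,
    frequently_atTop, Metric.mem_ball]

theorem isCompact_limitSet [ProperSpace V] {x : ℕ → V} {R : ℝ} (hx : ∀ n, ‖x n‖ ≤ R) :
    IsCompact (limitSet x) := by
  refine (isCompact_closedBall (0 : V) R).of_isClosed_subset isClosed_setOfPred_clusterPt ?_
  intro p hp
  refine isClosed_iff_clusterPt.1 Metric.isClosed_closedBall p (ClusterPt.mono hp ?_)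
  rw [le_principal_iff]
  exact mem_map.2 (Eventually.of_forall fun n => by simpa using hx n)

theorem limitSet_nonempty [ProperSpace V] {x : ℕ → V} {R : ℝ} (hx : ∀ n, ‖x n‖ ≤ R) :
    (limitSet x).Nonempty := by
  obtain ⟨p, -, hp⟩ := (isCompact_closedBall (0 : V) R).exists_mapClusterPt (u := x) (f := atTop)
    (le_principal_iff.2 (mem_map.2 (Eventually.of_forall fun n => by simpa using hx n)))
  exact ⟨p, hp⟩

theorem tendsto_infDist_limitSet [ProperSpace V] {x : ℕ → V} {R : ℝ} (hx : ∀ n, ‖x n‖ ≤ R) :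
    Tendsto (fun n => Metric.infDist (x n) (limitSet x)) atTop (𝓝 0) := by
  rw [Metric.tendsto_atTop']
  by_contra! hc
  obtain ⟨ε, hε, hfar⟩ := hc
  set K : Set V := Metric.closedBall 0 R ∩ {z | ε ≤ Metric.infDist z (limitSet x)} with hK
  have hKc : IsCompact K := (isCompact_closedBall (0 : V) R).inter_right
    (isClosed_le continuous_const (Metric.continuous_infDist_pt _))
  have hfreq : ∃ᶠ n in atTop, x n ∈ K := by
    rw [frequently_atTop]
    intro N
    obtain ⟨n, hn, h⟩ := hfar N
    refine ⟨n, hn.le, by simpa using hx n, ?_⟩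
    rwa [Real.dist_0_eq_abs, abs_of_nonneg Metric.infDist_nonneg] at h
  obtain ⟨p, hpK, hp⟩ := hKc.exists_mapClusterPt_of_frequently hfreq
  have hpS : p ∈ limitSet x := hp
  have := hpK.2
  rw [Set.mem_ofPred_eq, Metric.infDist_zero_of_mem hpS] at this
  linarith

variable [NormedSpace ℝ V]

/-- For `s ≥ 0`, the iterates are followed for time `s` from one near `γ 0`. For `s < 0`, an iterate
about `|s|` earlier is flowed forward to the vicinity of `γ 0`, and the two-sided Lipschitz estimate
carries this closeness back. -/
theorem isInvariantSet_limitSet [CompleteSpace V] {F : V → V} {L : ℝ≥0} (hF : LipschitzWith L F)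
    {a : ℕ → ℝ} (ha : ∀ n, 0 ≤ a n) (ha0 : Tendsto a atTop (𝓝 0))
    (hsum : Tendsto (clock a) atTop atTop) {x : ℕ → V}
    (hx : IsAsymptoticPseudotrajectory F a x) : IsInvariantSet F (limitSet x) := by
  intro γ hγ hγ0 s
  rw [mem_limitSet_iff] at hγ0 ⊢
  intro ε hε N
  have hL : (0 : ℝ) ≤ L := L.2
  set E := Real.exp (L * (|s| + 1)) with hE
  have hE0 : 0 < E := Real.exp_pos _
  obtain ⟨ρ, hρ, hργ⟩ := Metric.continuousAt_iff.1 (hγ.continuous.continuousAt (x := s))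
    (ε / 4) (by positivity)
  set κ := ε / (4 * (E + 1)) with hκ
  have hκ0 : 0 < κ := by positivity
  have hκE : κ * E + κ ≤ ε / 4 := by
    rw [hκ]; apply le_of_eq; field_simp
  have hκε : κ ≤ ε / 4 := le_trans (by nlinarith) hκE
  obtain ⟨N₁, hN₁⟩ := hx (|s| + 1) κ hκ0
  rcases lt_or_ge s 0 with hs | hs
  -- The bound `-s / 2` keeps the chosen clock time before `clock a n`, whence `k ≤ n`.
  · set η := min (ρ / 2) (min 1 (-s / 2)) with hη
    have hη0 : 0 < η := by
      refine lt_min (by positivity) (lt_min one_pos (by linarith))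
    have hηρ : η < ρ := (min_le_left _ _).trans_lt (by linarith)
    have hηs : η ≤ -s / 2 := (min_le_right _ _).trans (min_le_right _ _)
    obtain ⟨N₂, hN₂⟩ := eventually_atTop.1 (ha0.eventually_le_const hη0)
    set N' := max N (max N₁ N₂) with hN'
    -- Late enough that going back by `|s|` still lands after `N'`.
    obtain ⟨N₃, hN₃⟩ := eventually_atTop.1 (hsum.eventually_ge_atTop (clock a N' - s))
    obtain ⟨n, hn, hnp⟩ := hγ0 κ hκ0 N₃
    have hns := hN₃ n hn
    obtain ⟨k, hk, hk1, hk2⟩ := exists_clock_mem_Icc hsum (N := N') hη0.le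
      (fun j hj => hN₂ j (by omega)) (s := clock a n + s) (by linarith)
    refine ⟨k, by omega, ?_⟩
    have hkn : k ≤ n := by
      by_contra hc
      linarith [clock_mono ha (not_le.1 hc).le]
    obtain ⟨β, hβ, hβ0⟩ := exists_isTrajectory hF (x k)
    set u := clock a n - clock a k with hu
    have habs : |s| = -s := abs_of_neg hs
    have h1 : dist (x n) (β u) ≤ κ := hN₁ k (by omega) n hkn (by rw [habs]; linarith) β hβ hβ0
    have h2 := (hβ.shift u).dist_le hF hγ (-u)
    simp only [neg_add_cancel, zero_add, hβ0] at h2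
    have h3 : dist (β u) (γ 0) ≤ 2 * κ := by
      have := dist_triangle_left (β u) (γ 0) (x n)
      linarith
    have h4 : dist (x k) (γ (-u)) ≤ 2 * κ * E := by
      refine h2.trans ?_
      have hu' : |-u| ≤ |s| + 1 := by
        rw [abs_le, habs]; constructor <;> linarith
      rw [hE]
      gcongr
    have h5 : dist (γ (-u)) (γ s) < ε / 4 := hργ (by
      rw [Real.dist_eq, abs_lt]; constructor <;> linarith)
    have := dist_triangle (x k) (γ (-u)) (γ s)
    nlinarith
  · set η := min (ρ / 2) 1 with hη
    have hη0 : 0 < η := lt_min (by positivity) one_pos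
    have hηρ : η < ρ := (min_le_left _ _).trans_lt (by linarith)
    have hη1 : η ≤ 1 := min_le_right _ _
    obtain ⟨N₂, hN₂⟩ := eventually_atTop.1 (ha0.eventually_le_const hη0)
    set N' := max N (max N₁ N₂) with hN'
    obtain ⟨n, hn, hnp⟩ := hγ0 κ hκ0 N'
    obtain ⟨k, hk, hk1, hk2⟩ := exists_clock_mem_Icc hsum (N := n) hη0.le
      (fun j hj => hN₂ j (by omega)) (s := clock a n + s) (by linarith)
    refine ⟨k, by omega, ?_⟩
    obtain ⟨β, hβ, hβ0⟩ := exists_isTrajectory hF (x n)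
    set u := clock a k - clock a n with hu
    have habs : |s| = s := abs_of_nonneg hs
    have h1 : dist (x k) (β u) ≤ κ := hN₁ n (by omega) k hk (by rw [habs]; linarith) β hβ hβ0
    have h2 : dist (β u) (γ u) ≤ κ * E := by
      refine (hβ.dist_le hF hγ u).trans ?_
      have hu' : |u| ≤ |s| + 1 := by
        rw [abs_le, habs]; constructor <;> linarith
      rw [hβ0, hE]
      gcongr
    have h5 : dist (γ u) (γ s) < ε / 4 := hργ (by
      rw [Real.dist_eq, abs_lt]; constructor <;> linarith)
    have := dist_triangle4 (x k) (β u) (γ u) (γ s)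
    linarith

/-- Prepending a step to a chain. -/
theorem exists_chain_cons {α : Type*} {S : Set α} {r : α → α → Prop} {p p' q : α}
    (hp : p ∈ S) (hpp' : r p p')
    (h : ∃ n : ℕ, 1 ≤ n ∧ ∃ z : ℕ → α, z 0 = p' ∧ z n = q ∧ (∀ i ≤ n, z i ∈ S) ∧
      ∀ i < n, r (z i) (z (i + 1))) :
    ∃ n : ℕ, 1 ≤ n ∧ ∃ z : ℕ → α, z 0 = p ∧ z n = q ∧ (∀ i ≤ n, z i ∈ S) ∧
      ∀ i < n, r (z i) (z (i + 1)) := by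
  obtain ⟨n, hn, z, h0, hnq, hS, hr⟩ := h
  refine ⟨n + 1, by omega, fun i => Nat.casesOn i p z, rfl, hnq, ?_, ?_⟩
  · rintro (_ | i) hi
    · exact hp
    · exact hS i (by omega)
  · rintro (_ | i) hi
    · simpa [h0] using hpp'
    · exact hr i (by omega)

/-- The iterates between a visit near `p` and a later visit near `q` supply the chain: late iterates
spaced by at least `τ` are replaced by nearby limit points. -/
theorem isInternallyChainTransitive_limitSet [ProperSpace V] {F : V → V} {L : ℝ≥0}
    (hF : LipschitzWith L F) {a : ℕ → ℝ} (ha : ∀ n, 0 ≤ a n) (ha0 : Tendsto a atTop (𝓝 0))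
    (hsum : Tendsto (clock a) atTop atTop) {x : ℕ → V} {R : ℝ} (hxR : ∀ n, ‖x n‖ ≤ R)
    (hx : IsAsymptoticPseudotrajectory F a x) :
    IsInternallyChainTransitive F (limitSet x) := by
  intro p hp q hq ε hε τ hτ
  have hL : (0 : ℝ) ≤ L := L.2
  -- A regular link lasts between `τ` and `2 * τ`. It is used only if more than `3 * τ` remains, so
  -- more than `τ` is left after it; the last link takes the whole remainder.
  set E := Real.exp (L * (3 * τ)) with hE
  have hE0 : 0 < E := Real.exp_pos _
  set κ := ε / (3 * (E + 1)) with hκ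
  have hκ0 : 0 < κ := by positivity
  have hκE : κ * E + κ ≤ ε / 3 := by
    rw [hκ]; apply le_of_eq; field_simp
  have hκE0 : 0 < κ * E := by positivity
  have hxmem := tendsto_infDist_limitSet hxR
  obtain ⟨N₁, hN₁⟩ := hx (3 * τ) κ hκ0
  obtain ⟨N₂, hN₂⟩ := eventually_atTop.1 (ha0.eventually_le_const hτ)
  obtain ⟨N₃, hN₃⟩ := eventually_atTop.1 (hxmem.eventually_lt_const hκ0)
  set N := max N₁ (max N₂ N₃) with hN
  set r : V → V → Prop := fun z z' =>
    ∃ γ, IsTrajectory F γ ∧ γ 0 = z ∧ ∃ t ≥ τ, dist (γ t) z' < ε with hr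
  have hstep : ∀ n ≥ N, ∀ k ≥ n, clock a n + τ ≤ clock a k → clock a k ≤ clock a n + 3 * τ →
      ∀ z z', dist (x n) z < κ → dist (x k) z' < κ → r z z' := by
    intro n hn k hk h1 h2 z z' hz hz'
    obtain ⟨γ, hγ, hγ0⟩ := exists_isTrajectory hF z
    obtain ⟨β, hβ, hβ0⟩ := exists_isTrajectory hF (x n)
    refine ⟨γ, hγ, hγ0, clock a k - clock a n, by linarith, ?_⟩
    set u := clock a k - clock a n with hu
    have h3 := hN₁ n (by omega) k hk h2 β hβ hβ0
    have h4 : dist (γ u) (β u) ≤ κ * E := by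
      refine (hγ.dist_le hF hβ u).trans ?_
      have hu' : |u| ≤ 3 * τ := by rw [abs_le]; constructor <;> linarith
      rw [hγ0, hβ0, dist_comm, hE]
      gcongr
    have := dist_triangle4 (γ u) (β u) (x k) z'
    rw [dist_comm (β u)] at this
    linarith
  obtain ⟨n, hn, hnp⟩ := (mem_limitSet_iff.1 hp) κ hκ0 N
  obtain ⟨M, hM⟩ := eventually_atTop.1 (hsum.eventually_ge_atTop (clock a n + τ))
  obtain ⟨m, hm, hmq⟩ := (mem_limitSet_iff.1 hq) κ hκ0 (max M n)
  have hnm := hM m (by omega)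
  have key : ∀ j : ℕ, ∀ k, N ≤ k → k ≤ m → m - k ≤ j → clock a k + τ ≤ clock a m →
      ∀ z ∈ limitSet x, dist (x k) z < κ →
      ∃ n : ℕ, 1 ≤ n ∧ ∃ w : ℕ → V, w 0 = z ∧ w n = q ∧ (∀ i ≤ n, w i ∈ limitSet x) ∧
        ∀ i < n, r (w i) (w (i + 1)) := by
    intro j
    induction j with
    | zero =>
      intro k _ hkm hj hkt
      have : k = m := by omega
      subst this
      linarith
    | succ j ih =>
      intro k hNk hkm hj hkt z hz hzk
      rcases le_or_gt (clock a m) (clock a k + 3 * τ) with hle | hlt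
      · refine ⟨1, le_rfl, fun i => Nat.casesOn i z fun _ => q, rfl, rfl, ?_, ?_⟩
        · rintro (_ | i) hi
          · exact hz
          · exact hq
        · rintro (_ | i) hi
          · exact hstep k hNk m hkm hkt hle z q hzk hmq
          · omega
      · obtain ⟨k', hk', h1, h2⟩ := exists_clock_mem_Icc hsum (N := k) hτ.le
          (fun i hi => hN₂ i (by omega)) (s := clock a k + τ) (by linarith)
        obtain ⟨z', hz', hzk'⟩ := (Metric.infDist_lt_iff ⟨p, hp⟩).1 (hN₃ k' (by omega))
        have hkk' : k ≠ k' := by rintro rfl; linarith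
        have hk'm : k' ≤ m := by
          by_contra hc
          linarith [clock_mono ha (not_le.1 hc).le]
        exact exists_chain_cons hz (hstep k hNk k' hk' h1 (by linarith) z z' hzk hzk')
          (ih k' (by omega) hk'm (by omega) (by linarith) z' hz' hzk')
  exact key (m - n) n hn (by omega) le_rfl hnm p hp hnp

/-- A trajectory in `S` is connected and cannot pass between two separated pieces; jumps smaller
than the gap between them cannot either. So no chain joins the pieces. -/
theorem isPreconnected_of_isInternallyChainTransitive {F : V → V} {S : Set V}
    (hS : IsCompact S) (hinv : IsInvariantSet F S) (hict : IsInternallyChainTransitive F S) :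
    IsPreconnected S := by
  rw [isPreconnected_iff_subset_of_fully_disjoint_closed hS.isClosed]
  intro u v hu hv hSuv huv
  by_contra! hc
  obtain ⟨⟨q, hqS, hqu⟩, ⟨p, hpS, hpv⟩⟩ := hc.imp Set.not_subset.1 Set.not_subset.1
  have hpu : p ∈ u := (hSuv hpS).resolve_right hpv
  obtain ⟨ε, hε, hdisj⟩ := (huv.mono Set.inter_subset_right Set.inter_subset_right :
    Disjoint (S ∩ u) (S ∩ v)).exists_thickenings (hS.inter_right hu) (hS.isClosed.inter hv)
  obtain ⟨n, -, z, h0, hn, hzS, hz⟩ := hict p hpS q hqS ε hε 1 one_pos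
  have key : ∀ i ≤ n, z i ∈ u := by
    intro i
    induction i with
    | zero => intro _; rwa [h0]
    | succ i ih =>
      intro hi
      have hzi := ih (by omega)
      obtain ⟨γ, hγ, hγ0, t, -, ht⟩ := hz i (by omega)
      have hγS := hinv γ hγ (by rw [hγ0]; exact hzS i (by omega))
      have hrange : IsPreconnected (Set.range γ) := isPreconnected_range hγ.continuous
      have hγu : Set.range γ ⊆ u := by
        refine (isPreconnected_iff_subset_of_disjoint_closed.1 hrange u v hu hv
          (Set.range_subset_iff.2 fun s => hSuv (hγS s)) (by simp [huv.inter_eq])).resolve_right ?_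
        intro h
        exact Set.disjoint_left.1 huv hzi (hγ0 ▸ h ⟨0, rfl⟩)
      refine (hSuv (hzS _ hi)).resolve_right fun hzv => ?_
      refine Set.disjoint_left.1 hdisj (?_ : z (i + 1) ∈ _) ?_
      · exact Metric.mem_thickening_iff.2
          ⟨γ t, ⟨hγS t, hγu ⟨t, rfl⟩⟩, by rwa [dist_comm]⟩
      · exact Metric.self_subset_thickening hε _ ⟨hzS _ hi, hzv⟩
  exact hqu (hn ▸ key n le_rfl)

/-- **Benaïm's theorem.** The limit set of a bounded stochastic approximation recursion with
summable noise and vanishing bias is compact, connected, invariant and internally chain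
transitive. -/
theorem exists_internallyChainTransitive_of_recursion [ProperSpace V] {F : V → V} {L : ℝ≥0}
    (hF : LipschitzWith L F) {a : ℕ → ℝ} (ha : ∀ n, 0 ≤ a n) (ha0 : Tendsto a atTop (𝓝 0))
    (hsum : Tendsto (fun N => ∑ n ∈ Finset.range N, a n) atTop atTop)
    {x m e : ℕ → V} (hx : ∃ R, ∀ n, ‖x n‖ ≤ R)
    (hrec : ∀ n, x (n + 1) = x n + a n • (F (x n) + m n + e n))
    (hm : CauchySeq fun n => ∑ k ∈ Finset.range n, a k • m k) (he : Tendsto e atTop (𝓝 0)) :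
    ∃ S : Set V, IsCompact S ∧ IsConnected S ∧ IsInvariantSet F S ∧
      IsInternallyChainTransitive F S ∧
      Tendsto (fun n => Metric.infDist (x n) S) atTop (𝓝 0) := by
  have hap := isAsymptoticPseudotrajectory_of_recursion hF ha ha0 hx hrec hm he
  obtain ⟨R, hR⟩ := hx
  have hcpt := isCompact_limitSet hR
  have hinv := isInvariantSet_limitSet hF ha ha0 hsum hap
  have hict := isInternallyChainTransitive_limitSet hF ha ha0 hsum hR hap
  exact ⟨limitSet x, hcpt, ⟨limitSet_nonempty hR,
    isPreconnected_of_isInternallyChainTransitive hcpt hinv hict⟩, hinv, hict,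
    tendsto_infDist_limitSet hR⟩

end LimitSet

/-! ### Convergence of martingale series with summable conditional variances -/

section MartingaleNoise

variable {Ω : Type*} {m0 : MeasurableSpace Ω} {μ : Measure Ω}
  {ℱ : Filtration ℕ m0} {D : ℕ → Ω → ℝ}

/-- The event that the conditional variances of the increments up to time `n` sum up to at
most `C`. -/
def lowVarianceEvent (μ : Measure Ω) (ℱ : Filtration ℕ m0) (D : ℕ → Ω → ℝ) (C : ℝ) (n : ℕ) :
    Set Ω :=
  {ω | ∑ k ∈ Finset.range (n + 1), (μ[fun ω' => D k ω' ^ 2 | ℱ k]) ω ≤ C}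

/-- The sum of the increments, stopped before the conditional variances exceed `C`. -/
noncomputable def stoppedSum (μ : Measure Ω) (ℱ : Filtration ℕ m0) (D : ℕ → Ω → ℝ) (C : ℝ)
    (n : ℕ) (ω : Ω) : ℝ :=
  ∑ k ∈ Finset.range n, (lowVarianceEvent μ ℱ D C k).indicator (D k) ω

/-- The conditional variance of `D n` is already known at time `n`. Hence the decision to keep `D n`
precedes its realisation, which preserves the martingale property. -/
theorem measurableSet_lowVarianceEvent (C : ℝ) (n : ℕ) :
    MeasurableSet[ℱ n] (lowVarianceEvent μ ℱ D C n) := by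
  refine StronglyMeasurable.measurableSet_le ?_ stronglyMeasurable_const
  exact Finset.stronglyMeasurable_fun_sum _ fun k hk =>
    stronglyMeasurable_condExp.mono (ℱ.mono (Nat.lt_succ_iff.1 (Finset.mem_range.1 hk)))

theorem stoppedSum_succ (C : ℝ) (n : ℕ) :
    stoppedSum μ ℱ D C (n + 1) =
      stoppedSum μ ℱ D C n + (lowVarianceEvent μ ℱ D C n).indicator (D n) := by
  ext ω
  simp [stoppedSum, Finset.sum_range_succ]

theorem memLp_indicator_lowVarianceEvent (hD2 : ∀ n, MemLp (D n) 2 μ) (C : ℝ) (n : ℕ) :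
    MemLp ((lowVarianceEvent μ ℱ D C n).indicator (D n)) 2 μ :=
  (hD2 n).indicator (ℱ.le n _ (measurableSet_lowVarianceEvent C n))

theorem memLp_stoppedSum (hD2 : ∀ n, MemLp (D n) 2 μ) (C : ℝ) (n : ℕ) :
    MemLp (stoppedSum μ ℱ D C n) 2 μ :=
  memLp_finsetSum _ fun k _ => memLp_indicator_lowVarianceEvent hD2 C k

theorem stronglyAdapted_stoppedSum (hD : ∀ n, StronglyMeasurable[ℱ (n + 1)] (D n)) (C : ℝ) :
    StronglyAdapted ℱ (stoppedSum μ ℱ D C) := fun _ =>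
  Finset.stronglyMeasurable_fun_sum _ fun k hk =>
    ((hD k).mono (ℱ.mono (Finset.mem_range.1 hk))).indicator
      (ℱ.mono (Finset.mem_range.1 hk).le _ (measurableSet_lowVarianceEvent C k))

variable [IsProbabilityMeasure μ]

theorem condExp_indicator_lowVarianceEvent (hD2 : ∀ n, MemLp (D n) 2 μ)
    (hD0 : ∀ n, μ[D n | ℱ n] =ᵐ[μ] 0) (C : ℝ) (n : ℕ) :
    μ[(lowVarianceEvent μ ℱ D C n).indicator (D n) | ℱ n] =ᵐ[μ] 0 := by
  refine (condExp_indicator ((hD2 n).integrable one_le_two)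
    (measurableSet_lowVarianceEvent C n)).trans ?_
  filter_upwards [hD0 n] with ω hω
  by_cases h : ω ∈ lowVarianceEvent μ ℱ D C n <;> simp [h, hω]

theorem martingale_stoppedSum (hD : ∀ n, StronglyMeasurable[ℱ (n + 1)] (D n))
    (hD2 : ∀ n, MemLp (D n) 2 μ) (hD0 : ∀ n, μ[D n | ℱ n] =ᵐ[μ] 0) (C : ℝ) :
    Martingale (stoppedSum μ ℱ D C) ℱ μ := by
  refine martingale_of_condExp_sub_eq_zero_nat (stronglyAdapted_stoppedSum hD C)
    (fun n => (memLp_stoppedSum hD2 C n).integrable one_le_two) fun n => ?_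
  rw [stoppedSum_succ, add_sub_cancel_left]
  exact condExp_indicator_lowVarianceEvent hD2 hD0 C n

/-- Martingale increments are orthogonal, so only the squares survive; on an event of `ℱ k` the
square of `D k` integrates like its conditional expectation. -/
theorem integral_stoppedSum_sq (hD : ∀ n, StronglyMeasurable[ℱ (n + 1)] (D n))
    (hD2 : ∀ n, MemLp (D n) 2 μ) (hD0 : ∀ n, μ[D n | ℱ n] =ᵐ[μ] 0) (C : ℝ) (n : ℕ) :
    ∫ ω, stoppedSum μ ℱ D C n ω ^ 2 ∂μ = ∑ k ∈ Finset.range n,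
      ∫ ω, (lowVarianceEvent μ ℱ D C k).indicator (μ[fun ω' => D k ω' ^ 2 | ℱ k]) ω ∂μ := by
  induction n with
  | zero => simp [stoppedSum]
  | succ n ih =>
    set X := stoppedSum μ ℱ D C n with hX
    set A := lowVarianceEvent μ ℱ D C n with hA
    have hAm : MeasurableSet[ℱ n] A := measurableSet_lowVarianceEvent C n
    set Y := A.indicator (D n) with hY
    have hX2 : MemLp X 2 μ := memLp_stoppedSum hD2 C n
    have hY2 : MemLp Y 2 μ := memLp_indicator_lowVarianceEvent hD2 C n
    have hXY : Integrable (X * Y) μ := hX2.integrable_mul hY2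
    have hcross : ∫ ω, (X * Y) ω ∂μ = 0 := by
      rw [← integral_condExp (ℱ.le n)]
      have : μ[X * Y | ℱ n] =ᵐ[μ] 0 := by
        refine (condExp_mul_of_stronglyMeasurable_left (stronglyAdapted_stoppedSum hD C n) hXY
          (hY2.integrable one_le_two)).trans ?_
        filter_upwards [condExp_indicator_lowVarianceEvent hD2 hD0 C n] with ω hω
        simp [hY, hA, hω]
      rw [integral_congr_ae this]
      simp
    have hsq : ∫ ω, Y ω ^ 2 ∂μ = ∫ ω, A.indicator (μ[fun ω' => D n ω' ^ 2 | ℱ n]) ω ∂μ := by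
      have h1 : (fun ω => Y ω ^ 2) = A.indicator fun ω => D n ω ^ 2 := by
        ext ω
        by_cases h : ω ∈ A <;> simp [hY, h]
      rw [h1, integral_indicator (ℱ.le n _ hAm), integral_indicator (ℱ.le n _ hAm),
        setIntegral_condExp (ℱ.le n) (hD2 n).integrable_sq hAm]
    rw [Finset.sum_range_succ, ← ih, ← hsq, stoppedSum_succ]
    have h2 : ∀ ω, (X + Y) ω ^ 2 = X ω ^ 2 + 2 * (X * Y) ω + Y ω ^ 2 := fun ω => by
      simp only [Pi.add_apply, Pi.mul_apply]; ring
    simp_rw [← hX, ← hA, ← hY, h2]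
    have h3 : Integrable (fun ω => X ω ^ 2 + 2 * (X * Y) ω) μ :=
      hX2.integrable_sq.add (hXY.const_mul 2)
    rw [integral_add h3 hY2.integrable_sq, integral_add hX2.integrable_sq (hXY.const_mul 2), integral_const_mul, hcross]
    ring

/-- The variances that are collected before their sum exceeds `C` sum up to at most `C`. -/
theorem sum_ite_sum_le_le {w : ℕ → ℝ} (hw : ∀ n, 0 ≤ w n) {C : ℝ} (hC : 0 ≤ C) (n : ℕ) :
    ∑ k ∈ Finset.range n, (if ∑ j ∈ Finset.range (k + 1), w j ≤ C then w k else 0) ≤ C := by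
  have hle : ∀ n, ∑ k ∈ Finset.range n, (if ∑ j ∈ Finset.range (k + 1), w j ≤ C then w k else 0)
      ≤ ∑ k ∈ Finset.range n, w k := fun n =>
    Finset.sum_le_sum fun k _ => by split_ifs <;> simp [hw]
  induction n with
  | zero => simpa
  | succ n ih =>
    by_cases h : ∑ j ∈ Finset.range (n + 1), w j ≤ C
    · exact (hle _).trans h
    · rw [Finset.sum_range_succ, if_neg h, add_zero]
      exact ih

theorem integral_stoppedSum_sq_le (hD : ∀ n, StronglyMeasurable[ℱ (n + 1)] (D n))
    (hD2 : ∀ n, MemLp (D n) 2 μ) (hD0 : ∀ n, μ[D n | ℱ n] =ᵐ[μ] 0) {C : ℝ} (hC : 0 ≤ C) (n : ℕ) :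
    ∫ ω, stoppedSum μ ℱ D C n ω ^ 2 ∂μ ≤ C := by
  rw [integral_stoppedSum_sq hD hD2 hD0]
  have hint : ∀ k, Integrable
      ((lowVarianceEvent μ ℱ D C k).indicator (μ[fun ω' => D k ω' ^ 2 | ℱ k])) μ := fun k =>
    integrable_condExp.indicator (ℱ.le k _ (measurableSet_lowVarianceEvent C k))
  rw [← integral_finsetSum _ fun k _ => hint k]
  have hpos : ∀ᵐ ω ∂μ, ∀ k, 0 ≤ (μ[fun ω' => D k ω' ^ 2 | ℱ k]) ω :=
    ae_all_iff.2 fun k => condExp_nonneg (Eventually.of_forall fun ω => sq_nonneg (D k ω))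
  calc _ ≤ ∫ _, C ∂μ := by
        refine integral_mono_ae (integrable_finsetSum _ fun k _ => hint k) (integrable_const C) ?_
        filter_upwards [hpos] with ω hω
        simpa only [Set.indicator_apply, lowVarianceEvent, Set.mem_ofPred_eq]
          using sum_ite_sum_le_le hω hC n
    _ = C := by simp

/-- By `|s| ≤ 1 + s ^ 2` the second-moment bound yields the `L¹` bound of Doob's convergence
theorem. -/
theorem ae_tendsto_stoppedSum (hD : ∀ n, StronglyMeasurable[ℱ (n + 1)] (D n))
    (hD2 : ∀ n, MemLp (D n) 2 μ) (hD0 : ∀ n, μ[D n | ℱ n] =ᵐ[μ] 0) {C : ℝ} (hC : 0 ≤ C) :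
    ∀ᵐ ω ∂μ, ∃ c, Tendsto (fun n => stoppedSum μ ℱ D C n ω) atTop (𝓝 c) := by
  refine (martingale_stoppedSum hD hD2 hD0 C).submartingale.exists_ae_tendsto_of_bdd
    (R := (1 + C).toNNReal) fun n => ?_
  have hX2 := memLp_stoppedSum (ℱ := ℱ) hD2 C n
  have hX1 := hX2.integrable one_le_two
  rw [eLpNorm_one_eq_lintegral_enorm, ← ofReal_integral_norm_eq_lintegral_enorm hX1]
  refine ENNReal.ofReal_le_ofReal ?_
  calc ∫ ω, ‖stoppedSum μ ℱ D C n ω‖ ∂μ ≤ ∫ ω, (1 + stoppedSum μ ℱ D C n ω ^ 2) ∂μ := by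
        refine integral_mono hX1.norm ((integrable_const 1).add hX2.integrable_sq) fun ω => ?_
        simp only [Real.norm_eq_abs]
        nlinarith [sq_abs (stoppedSum μ ℱ D C n ω), sq_nonneg (|stoppedSum μ ℱ D C n ω| - 1)]
    _ = 1 + ∫ ω, stoppedSum μ ℱ D C n ω ^ 2 ∂μ := by
        rw [integral_add (integrable_const 1) hX2.integrable_sq]
        simp
    _ ≤ 1 + C := by linarith [integral_stoppedSum_sq_le (ℱ := ℱ) hD hD2 hD0 hC n]

/-- A series of square-integrable martingale differences converges almost surely on the event
that the conditional variances are summable. -/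
theorem ae_tendsto_sum_of_summable_condVar (hD : ∀ n, StronglyMeasurable[ℱ (n + 1)] (D n))
    (hD2 : ∀ n, MemLp (D n) 2 μ) (hD0 : ∀ n, μ[D n | ℱ n] =ᵐ[μ] 0)
    (hsum : ∀ᵐ ω ∂μ, Summable fun n => (μ[fun ω' => D n ω' ^ 2 | ℱ n]) ω) :
    ∀ᵐ ω ∂μ, ∃ c, Tendsto (fun n => ∑ k ∈ Finset.range n, D k ω) atTop (𝓝 c) := by
  have hpos : ∀ᵐ ω ∂μ, ∀ k, 0 ≤ (μ[fun ω' => D k ω' ^ 2 | ℱ k]) ω :=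
    ae_all_iff.2 fun k => condExp_nonneg (Eventually.of_forall fun ω => sq_nonneg (D k ω))
  have hconv : ∀ᵐ ω ∂μ, ∀ C : ℕ, ∃ c, Tendsto (fun n => stoppedSum μ ℱ D C n ω) atTop (𝓝 c) :=
    ae_all_iff.2 fun C => ae_tendsto_stoppedSum hD hD2 hD0 (Nat.cast_nonneg C)
  filter_upwards [hsum, hpos, hconv] with ω hω hωpos hωconv
  -- At a level above the total variance of this path nothing is stopped. Integer levels keep the
  -- exceptional null sets countable in number.
  obtain ⟨C, hC⟩ := exists_nat_ge (∑' n, (μ[fun ω' => D n ω' ^ 2 | ℱ n]) ω)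
  obtain ⟨c, hc⟩ := hωconv C
  refine ⟨c, hc.congr fun n => Finset.sum_congr rfl fun k _ => Set.indicator_of_mem ?_ _⟩
  exact (hω.sum_le_tsum _ fun k _ => hωpos k).trans hC

end MartingaleNoise

/-! ### Summing out the future of a sequence -/

section CausalSums

/-- Exchanging the entry at `s` with `v` is an involution on the pairs `(e, v)`. -/
theorem sum_sum_update {X V : Type*} [Fintype X] [AddCommGroup V] [Module ℝ V] {N : ℕ}
    (s : Fin N) (G : (Fin N → X) → V) :
    ∑ e, ∑ v, G (Function.update e s v) = (Fintype.card X : ℝ) • ∑ e, G e := by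
  have hinv : Function.Involutive fun p : (Fin N → X) × X => (Function.update p.1 s p.2, p.1 s) :=
    fun p => by simp
  have h : ∑ p : (Fin N → X) × X, G (Function.update p.1 s p.2) =
      ∑ p : (Fin N → X) × X, G p.1 :=
    Fintype.sum_equiv hinv.toPerm _ _ fun p => rfl
  rw [Fintype.sum_prod_type, Fintype.sum_prod_type] at h
  rw [h, Finset.smul_sum]
  exact Finset.sum_congr rfl fun e _ => by
    change ∑ _v : X, G e = _
    rw [Finset.sum_const, Finset.card_univ, Nat.cast_smul_eq_nsmul]

/-- A sum over all sequences vanishes if its summand is the product of a term that only depends on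
the entries up to `t` and that averages out over the entry at `t`, and of transition probabilities
for the later entries. -/
theorem sum_prod_smul_eq_zero {X V : Type*} [Fintype X] [AddCommGroup V] [Module ℝ V] {N : ℕ}
    (t : Fin N) (w : Fin N → (Fin N → X) → ℝ) (f : (Fin N → X) → V)
    (hw : ∀ s, ∀ r > s, ∀ e v, w s (Function.update e r v) = w s e)
    (hw1 : ∀ s > t, ∀ e, ∑ v, w s (Function.update e s v) = 1)
    (hf : ∀ s > t, ∀ e v, f (Function.update e s v) = f e)
    (hf0 : ∀ e, ∑ v, f (Function.update e t v) = 0) :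
    ∑ e, (∏ s ∈ Finset.Ioi t, w s e) • f e = 0 := by
  rcases isEmpty_or_nonempty X with hX | hX
  · have : IsEmpty (Fin N → X) := ⟨fun e => hX.false (e t)⟩
    simp
  have hcard : (Fintype.card X : ℝ) ≠ 0 := by simp
  -- Averaging over the last remaining entry removes its transition factor; once none is left after
  -- `t`, averaging over the entry at `t` gives zero.
  have key : ∀ m : ℕ, ∑ e, (∏ s ∈ (Finset.Ioi t).filter (fun s => s.val < m), w s e) • f e = 0 := by
    intro m
    induction m with
    | zero =>
      have h := sum_sum_update t f
      simp only [hf0, Finset.sum_const_zero] at h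
      simpa using (smul_eq_zero.1 h.symm).resolve_left hcard
    | succ m ih =>
      by_cases hm : ∃ hmN : m < N, t < ⟨m, hmN⟩
      · obtain ⟨hmN, htm⟩ := hm
        set s : Fin N := ⟨m, hmN⟩ with hs
        have hset : (Finset.Ioi t).filter (fun r => r.val < m + 1) =
            insert s ((Finset.Ioi t).filter fun r => r.val < m) := by
          ext r
          simp only [Finset.mem_filter, Finset.mem_insert, Finset.mem_Ioi, Fin.ext_iff, Fin.lt_def,
            hs] at htm ⊢
          omega
        have hnot : s ∉ (Finset.Ioi t).filter fun r => r.val < m := by simp [hs]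
        have h := sum_sum_update s fun e =>
          (∏ r ∈ (Finset.Ioi t).filter (fun r => r.val < m + 1), w r e) • f e
        have hinner : ∀ e, ∑ v, (∏ r ∈ (Finset.Ioi t).filter (fun r => r.val < m + 1),
            w r (Function.update e s v)) • f (Function.update e s v) =
            (∏ r ∈ (Finset.Ioi t).filter (fun r => r.val < m), w r e) • f e := by
          intro e
          have : ∀ v, (∏ r ∈ (Finset.Ioi t).filter (fun r => r.val < m + 1),
              w r (Function.update e s v)) • f (Function.update e s v) =
              w s (Function.update e s v) •
                (∏ r ∈ (Finset.Ioi t).filter (fun r => r.val < m), w r e) • f e := by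
            intro v
            rw [hset, Finset.prod_insert hnot, hf s htm, mul_smul]
            congr 2
            refine Finset.prod_congr rfl fun r hr => hw r s ?_ e v
            exact Fin.lt_def.2 (Finset.mem_filter.1 hr).2
          simp_rw [this]
          rw [← Finset.sum_smul, hw1 s htm, one_smul]
        rw [Finset.sum_congr rfl fun e _ => hinner e, ih] at h
        exact (smul_eq_zero.1 h.symm).resolve_left hcard
      · rw [← ih]
        refine Finset.sum_congr rfl fun e _ => ?_
        congr 2
        ext r
        simp only [Finset.mem_filter, Finset.mem_Ioi, and_congr_right_iff]
        intro hr
        constructor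
        · intro h
          refine lt_of_le_of_ne (Nat.lt_succ_iff.1 h) fun hrm => hm ⟨hrm ▸ r.2, ?_⟩
          rw [Fin.lt_def] at hr ⊢
          exact hrm ▸ hr
        · intro h; omega
  rw [← key N]
  refine Finset.sum_congr rfl fun e _ => ?_
  congr 2
  ext r
  simp

end CausalSums

/-! ### Causal factorisation of episode probabilities -/

namespace Episode

variable {O A : Type*} {T : ℕ}

theorem histAt_congr {e e' : Episode O A T} {t : Fin (T + 1)} (h : ∀ s < t, e s = e' s)
    (ht : (e t).1 = (e' t).1) : Episode.histAt e t = Episode.histAt e' t := by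
  rw [Episode.histAt, Episode.histAt, ht]
  congr 1
  funext i
  exact h _ (Fin.lt_def.2 i.2)

theorem hist_congr {e e' : Episode O A T} {t : Fin (T + 1)} (h : ∀ s < t, e s = e' s)
    (ht : (e t).1 = (e' t).1) : Episode.hist e t = Episode.hist e' t := by
  rw [Episode.hist, Episode.hist, histAt_congr h ht]

end Episode

namespace HDP

variable {O A : Type*} [Fintype O] [Fintype A] {T : ℕ}

/-- The probability of the observation `o` at time `t`, given the earlier part of the episode. -/
def obsLaw (E : HDP O A T) (e : Episode O A T) (t : Fin (T + 1)) (o : O) : ℝ :=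
  Fin.cases (motive := fun _ => ℝ) (E.pini o)
    (fun i => E.po i (Episode.histAt e i.castSucc) (e i.castSucc).2 o) t

theorem sum_obsLaw (E : HDP O A T) (e : Episode O A T) (t : Fin (T + 1)) :
    ∑ o, E.obsLaw e t o = 1 := by
  cases t using Fin.cases with
  | zero => exact E.pini_sum
  | succ i => exact E.po_sum i _ _

theorem obsLaw_congr (E : HDP O A T) {e e' : Episode O A T} {t : Fin (T + 1)}
    (h : ∀ s < t, e s = e' s) : E.obsLaw e t = E.obsLaw e' t := by
  funext o
  cases t using Fin.cases with
  | zero => rfl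
  | succ i =>
    have h1 : ∀ s ≤ i.castSucc, e s = e' s := fun s hs =>
      h s (lt_of_le_of_lt hs i.castSucc_lt_succ)
    change E.po i (Episode.histAt e i.castSucc) (e i.castSucc).2 o =
      E.po i (Episode.histAt e' i.castSucc) (e' i.castSucc).2 o
    rw [Episode.histAt_congr (fun s hs => h1 s hs.le) (by rw [h1 _ le_rfl]), h1 _ le_rfl]

/-- The probability of an episode with the action probability at time `t` left out. -/
def scoreWeight (E : HDP O A T) (π : History O A T → A → ℝ) (e : Episode O A T)
    (t : Fin (T + 1)) : ℝ :=
  (∏ s, E.obsLaw e s (e s).1) * ∏ s ∈ Finset.univ.erase t, π (Episode.hist e s) (e s).2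

theorem prob_eq (E : HDP O A T) (π : History O A T → A → ℝ) (e : Episode O A T) :
    E.prob π e = (∏ s, E.obsLaw e s (e s).1) * ∏ s, π (Episode.hist e s) (e s).2 := by
  rw [prob, Fin.prod_univ_succ (fun s => E.obsLaw e s (e s).1)]
  rfl

theorem prob_eq_scoreWeight_mul (E : HDP O A T) (π : History O A T → A → ℝ) (e : Episode O A T)
    (t : Fin (T + 1)) :
    E.prob π e = E.scoreWeight π e t * π (Episode.hist e t) (e t).2 := by
  rw [prob_eq, scoreWeight, mul_assoc, Finset.prod_erase_mul _ _ (Finset.mem_univ t)]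

/-- Terms that do not depend on the action at time `t` or on the later part of the episode do not
contribute to the policy gradient. -/
theorem sum_scoreWeight_smul_eq_zero {V : Type*} [AddCommGroup V] [Module ℝ V] (E : HDP O A T)
    {π : History O A T → A → ℝ} (hπ : ∀ h, ∑ a, π h a = 1) {v : History O A T → A → V}
    (hv : ∀ h, ∑ a, v h a = 0) (t : Fin (T + 1)) {c : Episode O A T → ℝ}
    (hc : ∀ e e', (∀ s < t, e s = e' s) → (e t).1 = (e' t).1 → c e = c e') :
    ∑ e, (c e * E.scoreWeight π e t) • v (Episode.hist e t) (e t).2 = 0 := by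
  classical
  set w : Fin (T + 1) → Episode O A T → ℝ := fun s e =>
    E.obsLaw e s (e s).1 * π (Episode.hist e s) (e s).2 with hw
  set f : Episode O A T → V := fun e =>
    ((∏ s ∈ Finset.Iio t, w s e) * (c e * E.obsLaw e t (e t).1)) •
      v (Episode.hist e t) (e t).2 with hf
  have hupd : ∀ {s r : Fin (T + 1)} (e : Episode O A T) (p : O × A), s ≠ r →
      Function.update e r p s = e s := fun e p h => Function.update_of_ne h _ _
  have hobs : ∀ {s r : Fin (T + 1)} (e : Episode O A T) (p : O × A), s ≤ r →
      E.obsLaw (Function.update e r p) s = E.obsLaw e s := fun e p h =>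
    E.obsLaw_congr fun u hu => hupd e p (hu.trans_le h).ne
  have hhist : ∀ {s r : Fin (T + 1)} (e : Episode O A T) (p : O × A), s < r →
      Episode.hist (Function.update e r p) s = Episode.hist e s := fun e p h =>
    Episode.hist_congr (fun u hu => hupd e p (hu.trans h).ne) (by rw [hupd e p h.ne])
  have hhist' : ∀ (s : Fin (T + 1)) (e : Episode O A T) (o : O) (a a' : A),
      Episode.hist (Function.update e s (o, a)) s =
        Episode.hist (Function.update e s (o, a')) s := fun s e o a a' =>
    Episode.hist_congr (fun u hu => by rw [hupd e _ hu.ne, hupd e _ hu.ne]) (by simp)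
  have hww : ∀ s, ∀ r > s, ∀ e p, w s (Function.update e r p) = w s e := fun s r hr e p => by
    simp only [hw, hobs e p hr.le, hhist e p hr, hupd e p hr.ne]
  have hsplit : ∀ e, (c e * E.scoreWeight π e t) • v (Episode.hist e t) (e t).2 =
      (∏ s ∈ Finset.Ioi t, w s e) • f e := by
    intro e
    simp only [hf]
    rw [smul_smul]
    congr 1
    have huniv : ∀ g : Fin (T + 1) → ℝ, ∏ s ∈ Finset.univ.erase t, g s =
        (∏ s ∈ Finset.Iio t, g s) * ∏ s ∈ Finset.Ioi t, g s := fun g => by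
      rw [← Finset.prod_union (Finset.disjoint_left.2 fun s h1 h2 =>
        (Finset.mem_Iio.1 h1).not_gt (Finset.mem_Ioi.1 h2))]
      refine Finset.prod_congr ?_ fun _ _ => rfl
      ext s
      simp [lt_or_lt_iff_ne]
    rw [scoreWeight, ← Finset.prod_erase_mul _ _ (Finset.mem_univ t), huniv, huniv, hw]
    simp only [Finset.prod_mul_distrib]
    ring
  rw [Finset.sum_congr rfl fun e _ => hsplit e]
  refine sum_prod_smul_eq_zero t w f hww ?_ ?_ ?_
  · intro s _ e
    rw [Fintype.sum_prod_type, ← E.sum_obsLaw e s]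
    refine Finset.sum_congr rfl fun o _ => ?_
    simp only [hw, hobs e _ le_rfl, Function.update_self]
    rw [← Finset.mul_sum]
    -- The history at time `s` does not involve the action at `s`, so an arbitrary reference action
    -- `a₀` can stand in for it.
    rcases isEmpty_or_nonempty A with hA | ⟨⟨a₀⟩⟩
    · have := hπ (Episode.hist e s)
      simp at this
    · rw [Finset.sum_congr rfl fun a _ => by rw [hhist' s e o a a₀], hπ, mul_one]
  · intro s hs e p
    simp only [hf, hobs e p hs.le, hhist e p hs, hupd e p hs.ne]
    rw [hc (Function.update e s p) e (fun u hu => hupd e p (hu.trans hs).ne) (by rw [hupd e p hs.ne])]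
    congr 2
    exact Finset.prod_congr rfl fun u hu => hww u s ((Finset.mem_Iio.1 hu).trans hs) e p
  · intro e
    rw [Fintype.sum_prod_type]
    refine Finset.sum_eq_zero fun o _ => ?_
    rcases isEmpty_or_nonempty A with hA | ⟨⟨a₀⟩⟩
    · simp
    have : ∀ a, f (Function.update e t (o, a)) =
        ((∏ s ∈ Finset.Iio t, w s e) * (c (Function.update e t (o, a₀)) * E.obsLaw e t o)) •
          v (Episode.hist (Function.update e t (o, a₀)) t) a := by
      intro a
      simp only [hf, hobs e _ le_rfl, Function.update_self, hhist' t e o a a₀]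
      rw [hc (Function.update e t (o, a)) (Function.update e t (o, a₀))
        (fun u hu => by rw [hupd e _ hu.ne, hupd e _ hu.ne]) (by simp)]
      rw [Finset.prod_congr rfl fun u hu => hww u t (Finset.mem_Iio.1 hu) e _]
    rw [Finset.sum_congr rfl fun a _ => this a, ← Finset.smul_sum, hv, smul_zero]

end HDP

/-! ### Mixed policies and their scores -/

section Policies

variable {O A : Type*} {T d : ℕ}

theorem gradient_log_mix {πX : EuclideanSpace ℝ (Fin d) → History O A T → A → ℝ}
    (hdiff : ∀ h a, Differentiable ℝ fun x => πX x h a) (lam : History O A T → ℝ)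
    (ρ : History O A T → A → ℝ) {x : EuclideanSpace ℝ (Fin d)} {h : History O A T} {a : A}
    (h0 : mix lam (πX x) ρ h a ≠ 0) :
    gradient (fun x' => Real.log (mix lam (πX x') ρ h a)) x =
      ((mix lam (πX x) ρ h a)⁻¹ * (1 - lam h)) • gradient (fun x' => πX x' h a) x := by
  have h1 : HasFDerivAt (fun x' => mix lam (πX x') ρ h a)
      ((1 - lam h) • fderiv ℝ (fun x' => πX x' h a) x) x :=
    (((hdiff h a) x).hasFDerivAt.const_mul (1 - lam h)).add_const (lam h * ρ h a)
  rw [gradient, (h1.log h0).fderiv, gradient, smul_smul]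
  simp

variable [Fintype A]

/-- A zero of a nonnegative function is a minimum. This covers actions of probability zero, where
the score is not meaningful. -/
theorem gradient_eq_zero_of_policy_eq_zero {πX : EuclideanSpace ℝ (Fin d) → History O A T → A → ℝ}
    (hπX : ∀ x, IsPolicy (πX x)) {x : EuclideanSpace ℝ (Fin d)} {h : History O A T} {a : A}
    (h0 : πX x h a = 0) : gradient (fun x' => πX x' h a) x = 0 := by
  have hmin : IsLocalMin (fun x' => πX x' h a) x :=
    Eventually.of_forall fun x' => by
      change πX x h a ≤ πX x' h a
      rw [h0]
      exact (hπX x').1 h a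
  rw [gradient, hmin.fderiv_eq_zero, map_zero]

theorem sum_gradient_policy {πX : EuclideanSpace ℝ (Fin d) → History O A T → A → ℝ}
    (hπX : ∀ x, IsPolicy (πX x)) (hdiff : ∀ h a, Differentiable ℝ fun x => πX x h a)
    (x : EuclideanSpace ℝ (Fin d)) (h : History O A T) :
    ∑ a, gradient (fun x' => πX x' h a) x = 0 := by
  simp only [gradient]
  rw [← map_sum, ← fderiv_fun_sum fun a _ => (hdiff h a) x]
  simp [(hπX _).2 h]

/-- The policies `ρ n` need not converge; it suffices that their values lie in `[0, 1]`. -/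
theorem tendsto_mix {π : History O A T → A → ℝ} {ρ : ℕ → History O A T → A → ℝ}
    (hρ : ∀ n, IsPolicy (ρ n)) {lam : ℕ → History O A T → ℝ}
    (hlam : ∀ h, Tendsto (fun n => lam n h) atTop (𝓝 0)) (h : History O A T) (a : A) :
    Tendsto (fun n => mix (lam n) π (ρ n) h a) atTop (𝓝 (π h a)) := by
  have hbdd : ∀ n, ‖ρ n h a‖ ≤ 1 := fun n => by
    rw [Real.norm_of_nonneg ((hρ n).1 h a), ← (hρ n).2 h]
    exact Finset.single_le_sum (fun a _ => (hρ n).1 h a) (Finset.mem_univ a)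
  have h1 : Tendsto (fun n => lam n h * ρ n h a) atTop (𝓝 0) :=
    (hlam h).zero_mul_isBoundedUnder_le ⟨1, by simpa using ⟨0, fun n _ => hbdd n⟩⟩
  have h2 := (((hlam h).const_sub 1).mul_const (π h a)).add h1
  simpa [mix] using h2

end Policies

/-! ### Policy gradient theorem and the limit of the expected update -/

namespace HDP

variable {O A : Type*} [Fintype O] [Fintype A] {T d e : ℕ}

/-- The policy gradient with the weights of an arbitrary policy `π` and, at each time `t`, the
factors `c · t`. -/
noncomputable def weightedGradient (E : HDP O A T) (π : History O A T → A → ℝ)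
    (c : Episode O A T → Fin (T + 1) → ℝ)
    (v : History O A T → A → EuclideanSpace ℝ (Fin d)) : EuclideanSpace ℝ (Fin d) :=
  ∑ ep, ∑ t, (c ep t * E.scoreWeight π ep t) • v (Episode.hist ep t) (ep t).2

/-- The sampled action probability cancels the inverse in the score. If it is zero, then `lam < 1`
forces `πX` to vanish there too, and with it the gradient, so both sides are zero. -/
theorem pgMap_eq_weightedGradient (E : HDP O A T)
    {πX : EuclideanSpace ℝ (Fin d) → History O A T → A → ℝ}
    (hπX : ∀ x, IsPolicy (πX x)) (hdiff : ∀ h a, Differentiable ℝ fun x => πX x h a)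
    {πY : EuclideanSpace ℝ (Fin e) → History O A T → A → ℝ} (hπY : ∀ y, IsPolicy (πY y))
    (b : History O A T → ℝ) {lam : History O A T → ℝ} (hlam0 : ∀ h, 0 ≤ lam h)
    (hlam1 : ∀ h, lam h < 1) (x : EuclideanSpace ℝ (Fin d)) (y : EuclideanSpace ℝ (Fin e)) :
    E.pgMap πX πY b lam x y = E.weightedGradient (mix lam (πX x) (πY y))
      (fun ep t => (E.ret ep t - b (Episode.hist ep t)) * (1 - lam (Episode.hist ep t)))
      (fun h a => gradient (fun x' => πX x' h a) x) := by
  rw [pgMap, expect, weightedGradient]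
  refine Finset.sum_congr rfl fun ep _ => ?_
  rw [Finset.smul_sum]
  refine Finset.sum_congr rfl fun t _ => ?_
  rw [E.prob_eq_scoreWeight_mul _ ep t]
  set h := Episode.hist ep t
  set a := (ep t).2
  by_cases h0 : mix lam (πX x) (πY y) h a = 0
  · have h1 : πX x h a = 0 := by
      have h2 := mul_nonneg (hlam0 h) ((hπY y).1 h a)
      have h3 := mul_nonneg (sub_nonneg.2 (hlam1 h).le) ((hπX x).1 h a)
      have h4 : (1 - lam h) * πX x h a = 0 := by
        rw [mix] at h0; linarith
      exact (mul_eq_zero.1 h4).resolve_left (by linarith [hlam1 h])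
    rw [h0, gradient_eq_zero_of_policy_eq_zero hπX h1]
    simp
  · rw [gradient_log_mix hdiff lam _ h0, smul_smul, smul_smul]
    congr 1
    field_simp

/-- This is the product rule: `J` is a polynomial in the action probabilities, and the observation
laws do not depend on `x`. -/
theorem hasGradientAt_J (E : HDP O A T)
    {πX : EuclideanSpace ℝ (Fin d) → History O A T → A → ℝ}
    (hdiff : ∀ h a, Differentiable ℝ fun x => πX x h a) (x : EuclideanSpace ℝ (Fin d)) :
    HasGradientAt (fun z => E.J (πX z)) (E.weightedGradient (πX x) (fun ep _ => E.ret ep 0)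
      (fun h a => gradient (fun x' => πX x' h a) x)) x := by
  rw [hasGradientAt_iff_hasFDerivAt]
  have h1 : ∀ ep : Episode O A T, HasFDerivAt
      (fun z => ((∏ s, E.obsLaw ep s (ep s).1) * E.ret ep 0) *
        ∏ s, πX z (Episode.hist ep s) (ep s).2)
      (((∏ s, E.obsLaw ep s (ep s).1) * E.ret ep 0) • ∑ t, (∏ s ∈ Finset.univ.erase t,
        πX x (Episode.hist ep s) (ep s).2) • fderiv ℝ
          (fun z => πX z (Episode.hist ep t) (ep t).2) x) x := fun ep =>
    (HasFDerivAt.finsetProd fun t _ => ((hdiff _ _) x).hasFDerivAt).const_mul _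
  have h2 := HasFDerivAt.fun_sum (u := Finset.univ) fun ep _ => h1 ep
  refine (h2.congr_fderiv ?_).congr_of_eventuallyEq (Eventually.of_forall fun z => ?_)
  · simp only [weightedGradient, map_sum, Finset.smul_sum, scoreWeight]
    refine Finset.sum_congr rfl fun ep _ => Finset.sum_congr rfl fun t _ => ?_
    rw [smul_smul, LinearIsometryEquiv.map_smul, toDual_gradient]
    congr 1
    ring
  · simp only [J, expect, smul_eq_mul, prob_eq]
    exact Finset.sum_congr rfl fun ep _ => by ring

/-- **Policy gradient theorem**, with a baseline and with returns in place of total returns. -/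
theorem gradient_J_eq (E : HDP O A T)
    {πX : EuclideanSpace ℝ (Fin d) → History O A T → A → ℝ}
    (hπX : ∀ x, IsPolicy (πX x)) (hdiff : ∀ h a, Differentiable ℝ fun x => πX x h a)
    (b : History O A T → ℝ) (x : EuclideanSpace ℝ (Fin d)) :
    gradient (fun z => E.J (πX z)) x = E.weightedGradient (πX x)
      (fun ep t => E.ret ep t - b (Episode.hist ep t))
      (fun h a => gradient (fun x' => πX x' h a) x) := by
  rw [(E.hasGradientAt_J hdiff x).gradient, ← sub_eq_zero]
  simp only [weightedGradient, ← Finset.sum_sub_distrib, ← sub_smul, ← sub_mul]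
  rw [Finset.sum_comm]
  refine Finset.sum_eq_zero fun t _ => ?_
  refine E.sum_scoreWeight_smul_eq_zero (hπX x).2 (sum_gradient_policy hπX hdiff x) t
    -- This difference is the reward collected before `t` plus the baseline, so it is determined
    -- before the action at `t` is chosen.
    (c := fun ep => E.ret ep 0 - (E.ret ep t - b (Episode.hist ep t))) fun ep ep' h ht => ?_
  have hret : ∀ ep, E.ret ep 0 - E.ret ep t =
      ∑ k ∈ Finset.Iio t, E.rew (Episode.hist ep k) (ep k).2 := fun ep => by
    rw [ret, ret, sub_eq_iff_eq_add, ← Finset.sum_union (Finset.disjoint_left.2 fun s h1 h2 =>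
      (Finset.mem_Iio.1 h1).not_ge (Finset.mem_Ici.1 h2))]
    refine Finset.sum_congr ?_ fun _ _ => rfl
    ext s
    simp [lt_or_ge]
  have hb := Episode.hist_congr h ht
  have hsum : ∑ k ∈ Finset.Iio t, E.rew (Episode.hist ep k) (ep k).2 =
      ∑ k ∈ Finset.Iio t, E.rew (Episode.hist ep' k) (ep' k).2 :=
    Finset.sum_congr rfl fun k hk => by
      have hkt := Finset.mem_Iio.1 hk
      rw [h k hkt, Episode.hist_congr (fun s hs => h s (hs.trans hkt)) (by rw [h k hkt])]
  have h1 := hret ep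
  have h2 := hret ep'
  rw [hb]
  linarith

/-- As the mixing probability vanishes, the expected update converges to the policy gradient. -/
theorem tendsto_pgMap (E : HDP O A T)
    {πX : EuclideanSpace ℝ (Fin d) → History O A T → A → ℝ}
    (hπX : ∀ x, IsPolicy (πX x)) (hdiff : ∀ h a, Differentiable ℝ fun x => πX x h a)
    {πY : EuclideanSpace ℝ (Fin e) → History O A T → A → ℝ} (hπY : ∀ y, IsPolicy (πY y))
    (b : History O A T → ℝ) {lam : ℕ → History O A T → ℝ} (hlam0 : ∀ n h, 0 ≤ lam n h)
    (hlam1 : ∀ n h, lam n h < 1) (hlam : ∀ h, Tendsto (fun n => lam n h) atTop (𝓝 0))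
    (x : EuclideanSpace ℝ (Fin d)) (y : ℕ → EuclideanSpace ℝ (Fin e)) :
    Tendsto (fun n => E.pgMap πX πY b (lam n) x (y n)) atTop
      (𝓝 (gradient (fun z => E.J (πX z)) x)) := by
  rw [E.gradient_J_eq hπX hdiff b]
  simp only [fun n => E.pgMap_eq_weightedGradient hπX hdiff hπY b (hlam0 n) (hlam1 n) x (y n),
    weightedGradient, scoreWeight]
  refine tendsto_finsetSum _ fun ep _ => tendsto_finsetSum _ fun t _ => Tendsto.smul_const ?_ _
  refine Tendsto.mul ?_ (tendsto_const_nhds.mul (tendsto_finsetProd _ fun s _ =>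
    tendsto_mix (fun n => hπY (y n)) hlam _ _))
  simpa using ((hlam (Episode.hist ep t)).const_sub 1).const_mul
    (E.ret ep t - b (Episode.hist ep t))

end HDP

/-- A pointwise limit of `L`-Lipschitz functions is `L`-Lipschitz. -/
theorem lipschitzWith_of_tendsto {X Y : Type*} [PseudoMetricSpace X] [PseudoMetricSpace Y]
    {f : ℕ → X → Y} {F : X → Y} {L : ℝ≥0} (hf : ∀ n, LipschitzWith L (f n))
    (hlim : ∀ x, Tendsto (fun n => f n x) atTop (𝓝 (F x))) : LipschitzWith L F :=
  LipschitzWith.of_dist_le_mul fun x x' => le_of_tendsto ((hlim x).dist (hlim x'))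
    (Eventually.of_forall fun n => (hf n).dist_le_mul x x')

/-- A pointwise convergent sequence of `L`-Lipschitz functions converges along every sequence of
points that stays in a compact set. -/
theorem tendsto_dist_zero_of_lipschitzWith {X Y : Type*} [PseudoMetricSpace X]
    [PseudoMetricSpace Y] {f : ℕ → X → Y} {F : X → Y} {L : ℝ≥0} (hf : ∀ n, LipschitzWith L (f n))
    (hlim : ∀ x, Tendsto (fun n => f n x) atTop (𝓝 (F x))) {S : Set X} (hS : IsCompact S)
    {x : ℕ → X} (hx : ∀ n, x n ∈ S) :
    Tendsto (fun n => dist (f n (x n)) (F (x n))) atTop (𝓝 0) := by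
  have hF := lipschitzWith_of_tendsto hf hlim
  rw [Metric.tendsto_atTop]
  intro ε hε
  set ρ : ℝ := ε / (3 * (L + 1)) with hρ
  have hρ0 : 0 < ρ := by positivity
  have hLρ : L * ρ < ε / 3 := by
    have : (L + 1) * ρ = ε / 3 := by rw [hρ]; field_simp
    linarith
  -- On a finite `ρ`-net pointwise convergence is uniform; moving to the nearest centre and back
  -- costs at most `2 * L * ρ`.
  obtain ⟨t, -, ht, hcov⟩ := hS.finite_cover_balls hρ0
  have hev : ∀ᶠ n in atTop, ∀ z ∈ t, dist (f n z) (F z) < ε / 3 :=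
    (ht.eventually_all).2 fun z _ =>
      (tendsto_iff_dist_tendsto_zero.1 (hlim z)).eventually_lt_const (by positivity)
  obtain ⟨N, hN⟩ := eventually_atTop.1 hev
  refine ⟨N, fun n hn => ?_⟩
  obtain ⟨z, hz, hxz⟩ := Set.mem_iUnion₂.1 (hcov (hx n))
  rw [Metric.mem_ball] at hxz
  have h1 : dist (f n (x n)) (f n z) ≤ L * ρ :=
    ((hf n).dist_le_mul _ _).trans (mul_le_mul_of_nonneg_left hxz.le L.2)
  have h2 : dist (F z) (F (x n)) ≤ L * ρ := by
    rw [dist_comm]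
    exact (hF.dist_le_mul _ _).trans (mul_le_mul_of_nonneg_left hxz.le L.2)
  have h3 := hN n hn z hz
  have h4 := dist_triangle4 (f n (x n)) (f n z) (F z) (F (x n))
  rw [Real.dist_0_eq_abs, abs_of_nonneg dist_nonneg]
  linarith

/-! ### Summability of the noise along the iterates -/

section Noise

variable {Ω V W : Type*} [MeasurableSpace V] [MeasurableSpace W]

theorem sigmaField_mono (x M : ℕ → Ω → V) (y N : ℕ → Ω → W) : Monotone (sigmaField x y M N) :=
  fun _ _ h => biSup_mono fun _ hk => hk.trans h

theorem measurable_sigmaField (x M : ℕ → Ω → V) (y N : ℕ → Ω → W) (n : ℕ) :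
    Measurable[sigmaField x y M N n] (M n) := by
  have h : Measurable[sigmaField x y M N n] fun ω => (x n ω, y n ω, M n ω, N n ω) :=
    (comap_measurable _).mono (le_iSup₂_of_le n le_rfl le_rfl) le_rfl
  exact h.snd.snd.fst

variable [m0 : MeasurableSpace Ω]

theorem sigmaField_le {x M : ℕ → Ω → V} {y N : ℕ → Ω → W} (hx : ∀ n, Measurable (x n))
    (hM : ∀ n, Measurable (M n)) (hy : ∀ n, Measurable (y n)) (hN : ∀ n, Measurable (N n)) (n : ℕ) :
    sigmaField x y M N n ≤ m0 :=
  iSup₂_le fun m _ => ((hx m).prodMk ((hy m).prodMk ((hM m).prodMk (hN m)))).comap_le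

/-- The filtration of the iterates and the noise, from time `1` on. -/
def iterateFiltration {x M : ℕ → Ω → V} {y N : ℕ → Ω → W} (hx : ∀ n, Measurable (x n))
    (hM : ∀ n, Measurable (M n)) (hy : ∀ n, Measurable (y n)) (hN : ∀ n, Measurable (N n)) :
    Filtration ℕ m0 where
  seq n := sigmaField x y M N (n + 1)
  mono' _ _ h := sigmaField_mono x M y N (Nat.succ_le_succ h)
  le' n := sigmaField_le hx hM hy hN (n + 1)

end Noise

/-- Martingale difference noise with conditional variance bounded along bounded iterates is
summable with square-summable weights. -/
theorem ae_cauchySeq_sum_noise {Ω W : Type*} [MeasurableSpace Ω] [MeasurableSpace W] {d : ℕ}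
    {μ : Measure Ω} [IsProbabilityMeasure μ] {α : ℕ → ℝ} (hα_sq : Summable fun n => α n ^ 2)
    {x M : ℕ → Ω → EuclideanSpace ℝ (Fin d)} {y N : ℕ → Ω → W}
    (hx : ∀ n, Measurable (x n)) (hM : ∀ n, Measurable (M n))
    (hy : ∀ n, Measurable (y n)) (hN : ∀ n, Measurable (N n))
    (hM_sq : ∀ n, 1 ≤ n → MemLp (M (n + 1)) 2 μ)
    (hM_mds : ∀ n, 1 ≤ n → μ[M (n + 1) | sigmaField x y M N n] =ᵐ[μ] 0)
    (K : Ω → ℝ)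
    (hM_var : ∀ n, 1 ≤ n → ∀ᵐ ω ∂μ,
      (μ[fun ω' => ‖M (n + 1) ω'‖ ^ 2 | sigmaField x y M N n]) ω ≤ K ω * (1 + ‖x n ω‖ ^ 2))
    (hx_bdd : ∀ᵐ ω ∂μ, BddAbove (Set.range fun n => ‖x n ω‖)) :
    ∀ᵐ ω ∂μ, CauchySeq fun n => ∑ k ∈ Finset.range n, α k • M (k + 1) ω := by
  set ℱ := iterateFiltration hx hM hy hN with hℱ
  have hseq : ∀ n, ℱ n = sigmaField x y M N (n + 1) := fun n => rfl
  -- The noise hypotheses begin at `n = 1` and say nothing about the integrability of `M 1`. The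
  -- term `α 0 • M 1` is therefore left out here and added back at the end as a fixed vector.
  have hcoord : ∀ i : Fin d, ∀ᵐ ω ∂μ, ∃ c, Tendsto
      (fun n => ∑ k ∈ Finset.range n, α (k + 1) * M (k + 2) ω i) atTop (𝓝 c) := by
    intro i
    set π : EuclideanSpace ℝ (Fin d) →L[ℝ] ℝ := EuclideanSpace.proj i with hπ
    have hMi : ∀ n, MemLp (fun ω => M (n + 2) ω i) 2 μ := fun n =>
      π.comp_memLp' (hM_sq (n + 1) (by omega))
    refine ae_tendsto_sum_of_summable_condVar (ℱ := ℱ)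
      (D := fun n ω => α (n + 1) * M (n + 2) ω i) (fun n => ?_) (fun n => (hMi n).const_mul _)
      (fun n => ?_) ?_
    · have h1 : Measurable[ℱ (n + 1)] (M (n + 2)) := measurable_sigmaField x M y N (n + 2)
      exact ((π.measurable.comp h1).const_mul _).stronglyMeasurable
    · have h1 := condExp_smul (μ := μ) (α (n + 1)) (fun ω => M (n + 2) ω i) (ℱ n)
      have h2 := π.comp_condExp_comm (m := ℱ n) ((hM_sq (n + 1) (by omega)).integrable one_le_two)
      refine h1.trans ?_
      filter_upwards [h2, hM_mds (n + 1) (by omega)] with ω h3 h4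
      have h5 : (μ[fun ω => M (n + 2) ω i | ℱ n]) ω = 0 := by
        refine Eq.trans h3.symm ?_
        rw [hseq, Function.comp_apply, h4]
        simp
      rw [Pi.smul_apply, h5]
      simp
    · have hle : ∀ n, ∀ᵐ ω ∂μ, (μ[fun ω' => (α (n + 1) * M (n + 2) ω' i) ^ 2 | ℱ n]) ω ≤
          α (n + 1) ^ 2 * (K ω * (1 + ‖x (n + 1) ω‖ ^ 2)) := by
        intro n
        have hint : Integrable (fun ω => ‖M (n + 2) ω‖ ^ 2) μ :=
          (hM_sq (n + 1) (by omega)).integrable_norm_pow two_ne_zero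
        have h1 : μ[fun ω' => (α (n + 1) * M (n + 2) ω' i) ^ 2 | ℱ n] ≤ᵐ[μ]
            μ[α (n + 1) ^ 2 • fun ω => ‖M (n + 2) ω‖ ^ 2 | ℱ n] := by
          refine condExp_mono ((hMi n).const_mul _).integrable_sq (hint.smul _)
            (Eventually.of_forall fun ω => ?_)
          simp only [Pi.smul_apply, smul_eq_mul, mul_pow]
          refine mul_le_mul_of_nonneg_left ?_ (sq_nonneg _)
          rw [← sq_abs, ← Real.norm_eq_abs]
          exact pow_le_pow_left₀ (norm_nonneg _) (PiLp.norm_apply_le _ i) 2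
        filter_upwards [h1, condExp_smul (μ := μ) (α (n + 1) ^ 2)
          (fun ω => ‖M (n + 2) ω‖ ^ 2) (ℱ n), hM_var (n + 1) (by omega)] with ω h2 h3 h4
        refine h2.trans (h3.le.trans ?_)
        rw [Pi.smul_apply, smul_eq_mul]
        exact mul_le_mul_of_nonneg_left h4 (sq_nonneg _)
      have hpos : ∀ᵐ ω ∂μ, ∀ n, 0 ≤ (μ[fun ω' => (α (n + 1) * M (n + 2) ω' i) ^ 2 | ℱ n]) ω :=
        ae_all_iff.2 fun n => condExp_nonneg (Eventually.of_forall fun ω => sq_nonneg _)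
      -- `K` and the bound `R` depend on the path, so summability is only pathwise. The absolute
      -- value is taken because `K ω` has no assumed sign.
      filter_upwards [ae_all_iff.2 hle, hpos, hx_bdd] with ω h1 h2 ⟨R, hR⟩
      have hR' : ∀ n, ‖x n ω‖ ≤ R := fun n => hR ⟨n, rfl⟩
      refine Summable.of_nonneg_of_le h2 (fun n => (h1 n).trans ?_)
        (((summable_nat_add_iff 1).2 hα_sq).mul_right (|K ω| * (1 + R ^ 2)))
      refine mul_le_mul_of_nonneg_left ?_ (sq_nonneg _)
      have := hR' (n + 1)
      gcongr
      exact le_abs_self _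
  filter_upwards [ae_all_iff.2 hcoord] with ω hω
  choose c hc using hω
  have hlim : Tendsto (fun n => ∑ k ∈ Finset.range n, α (k + 1) • M (k + 2) ω) atTop
      (𝓝 (WithLp.toLp 2 c)) := by
    have h1 : Tendsto (fun n i => ∑ k ∈ Finset.range n, α (k + 1) * M (k + 2) ω i) atTop (𝓝 c) :=
      tendsto_pi_nhds.2 hc
    refine (((PiLp.continuous_toLp 2 _).tendsto c).comp h1).congr fun n => ?_
    ext i
    simp
  refine Tendsto.cauchySeq (x := WithLp.toLp 2 c + α 0 • M 1 ω)
    ((tendsto_add_atTop_iff_nat 1).1 ?_)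
  simp only [Finset.sum_range_succ' _ (_ : ℕ), zero_add, add_assoc, Nat.reduceAdd]
  exact hlim.add_const _

end PGMCTS

theorem proposition3
    -- the decision process, the two policy models and the baseline
    {O A : Type*} [Fintype O] [Fintype A] {T d e : ℕ} (E : PGMCTS.HDP O A T)
    (πX : EuclideanSpace ℝ (Fin d) → PGMCTS.History O A T → A → ℝ)
    (hπX : ∀ x, PGMCTS.IsPolicy (πX x))
    (hπX_diff : ∀ h a, Differentiable ℝ fun x => πX x h a)
    (πY : EuclideanSpace ℝ (Fin e) → PGMCTS.History O A T → A → ℝ)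
    (hπY : ∀ y, PGMCTS.IsPolicy (πY y))
    (b : PGMCTS.History O A T → ℝ)
    -- the mixing probability is `o(1)` and at most `1 - ε`
    (lam : ℕ → PGMCTS.History O A T → ℝ) (ε : ℝ) (hε : 0 < ε)
    (hlam : ∀ n h, 0 ≤ lam n h ∧ lam n h ≤ 1 - ε)
    (hlam_lim : ∀ h, Tendsto (fun n => lam n h) atTop (𝓝 0))
    -- the expected update function of the PG policy is Lipschitz in `x`
    (L : ℝ≥0) (hL : ∀ n y, LipschitzWith L fun x => E.pgMap πX πY b (lam n) x y)
    -- step sizes of the PG policy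
    (α : ℕ → ℝ) (hα : ∀ n, 0 ≤ α n)
    (hα_sum : Tendsto (fun N => ∑ n ∈ Finset.range N, α n) atTop atTop)
    (hα_sq : Summable fun n => α n ^ 2)
    -- the iterates, noise terms `M`, `N` and bias terms `β`, `δ`
    {Ω : Type*} [MeasurableSpace Ω] (μ : Measure Ω) [IsProbabilityMeasure μ]
    (x M : ℕ → Ω → EuclideanSpace ℝ (Fin d)) (y N : ℕ → Ω → EuclideanSpace ℝ (Fin e))
    (β : ℕ → Ω → EuclideanSpace ℝ (Fin d)) (δ : ℕ → Ω → EuclideanSpace ℝ (Fin e))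
    (hx : ∀ n, Measurable (x n)) (hM : ∀ n, Measurable (M n))
    (hy : ∀ n, Measurable (y n)) (hN : ∀ n, Measurable (N n))
    (hx_rec : ∀ n, ∀ᵐ ω ∂μ, x (n + 1) ω = x n ω +
      α n • (E.pgMap πX πY b (lam n) (x n ω) (y n ω) + M (n + 1) ω + β n ω))
    (η : ℕ → ℝ)
    (g : EuclideanSpace ℝ (Fin d) → EuclideanSpace ℝ (Fin e) → EuclideanSpace ℝ (Fin e))
    (hy_rec : ∀ n, ∀ᵐ ω ∂μ, y (n + 1) ω = y n ω +
      η n • (g (x n ω) (y n ω) + N (n + 1) ω + δ n ω))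
    -- noise and bias of the PG iterate
    (hM_sq : ∀ n, 1 ≤ n → MemLp (M (n + 1)) 2 μ)
    (hM_mds : ∀ n, 1 ≤ n → μ[M (n + 1) | PGMCTS.sigmaField x y M N n] =ᵐ[μ] 0)
    (K : Ω → ℝ)
    (hM_var : ∀ n, 1 ≤ n → ∀ᵐ ω ∂μ,
      (μ[fun ω' => ‖M (n + 1) ω'‖ ^ 2 | PGMCTS.sigmaField x y M N n]) ω
        ≤ K ω * (1 + ‖x n ω‖ ^ 2))
    (hβ : ∀ᵐ ω ∂μ, Tendsto (fun n => β n ω) atTop (𝓝 0))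
    -- boundedness of the PG iterate
    (hx_bdd : ∀ᵐ ω ∂μ, BddAbove (Set.range fun n => ‖x n ω‖)) :
    ∀ᵐ ω ∂μ, ∃ S : Set (EuclideanSpace ℝ (Fin d)),
      IsCompact S ∧ IsConnected S ∧
      PGMCTS.IsInvariantSet (gradient fun z => E.J (πX z)) S ∧
      PGMCTS.IsInternallyChainTransitive (gradient fun z => E.J (πX z)) S ∧
      Tendsto (fun n => Metric.infDist (x n ω) S) atTop (𝓝 0) := by
  have hlam1 : ∀ n h, lam n h < 1 := fun n h => by linarith [(hlam n h).2]
  have hlim := E.tendsto_pgMap hπX hπX_diff hπY b (fun n h => (hlam n h).1) hlam1 hlam_lim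
  -- Any fixed `y` serves here, because the limit does not depend on it.
  have hF : LipschitzWith L (gradient fun z => E.J (πX z)) :=
    PGMCTS.lipschitzWith_of_tendsto (fun n => hL n 0) fun z => hlim z fun _ => 0
  have hα0 : Tendsto α atTop (𝓝 0) := by
    have h := hα_sq.tendsto_atTop_zero.sqrt
    simpa only [Real.sqrt_sq (hα _), Real.sqrt_zero] using h
  have hnoise := PGMCTS.ae_cauchySeq_sum_noise hα_sq hx hM hy hN hM_sq hM_mds K hM_var hx_bdd
  filter_upwards [ae_all_iff.2 hx_rec, hβ, hx_bdd, hnoise] with ω hrec hβω ⟨R, hR⟩ hcauchy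
  have hxR : ∀ n, ‖x n ω‖ ≤ R := fun n => hR ⟨n, rfl⟩
  -- The whole influence of the MCTS policy becomes bias. Freezing `y n ω` into the `n`-th function
  -- is harmless, as the Lipschitz constant is uniform in `y` and the pointwise limit holds along
  -- every sequence.
  have hbias : Tendsto (fun n => E.pgMap πX πY b (lam n) (x n ω) (y n ω) -
      gradient (fun z => E.J (πX z)) (x n ω)) atTop (𝓝 0) := by
    rw [tendsto_zero_iff_norm_tendsto_zero]
    simp only [← dist_eq_norm]
    exact PGMCTS.tendsto_dist_zero_of_lipschitzWith
      (f := fun n z => E.pgMap πX πY b (lam n) z (y n ω)) (fun n => hL n (y n ω))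
      (fun z => hlim z fun n => y n ω) (isCompact_closedBall 0 R) fun n => by simpa using hxR n
  refine PGMCTS.exists_internallyChainTransitive_of_recursion hF hα hα0 hα_sum
    (m := fun n => M (n + 1) ω) ⟨R, hxR⟩ (fun n => ?_) hcauchy
    (by simpa using hbias.add hβω)
  rw [hrec n]
  congr 2
  abel
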